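/- Theorem 3.1. Let $\alpha\in(0,1)$, $\kappa_g>0$, and let $g=(g(x))_{x\in\mathbb R}$ be a jointly measurable (for example, continuous) centered stationary Gaussian field on a probability space, with $\mathbb E[g(0)^2]=1$ and $$R_g(x):=\mathbb E[g(0)g(x)]\sim \kappa_g|x|^{-\alpha}\qquad (|x|\to\infty).$$ Let $Z\sim N(0,1)$ and let $\Phi:\mathbb R\to\mathbb R$ be a $C^2$ function with bounded second derivative and $\mathbb E[\Phi(Z)^2]<\infty$. For $q\ge 0$ put $V_q=\mathbb E[\Phi(Z)H_q(Z)]$, where $H_q$ is the $q$-th probabilists' Hermite polynomial. Assume that $\Phi$ has Hermite rank $1$, i.e. the smallest $q\ge 0$ with $V_q\neq 0$ is $q=1$; thus $\mathbb E[\Phi(Z)]=0$ and $V_1=\mathbb E[Z\Phi(Z)]\ne 0$. Set $a(x)=\Phi(g(x))$, and for $\varepsilon>0$, $x\in\mathbb R$, $$W_\varepsilon(x)=\varepsilon^{-\alpha/2}\int_0^x a(y/\varepsilon)\,dy .$$ Let $H=1-\alpha/2$ and $\beta=\sqrt{V_1^2\kappa_g/(H(2H-1))}$. Then: 1. Almost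 surely $a$ is locally integrable, so that almost surely, for every $\varepsilon>0$, $W_\varepsilon$ is well defined and has continuous paths. 2. There exists a fractional Brownian motion $W^H$ on $\mathbb R$ with Hurst index $H$ and continuous paths, that is, a centered Gaussian process with $\mathbb E[W^H(x)W^H(y)]=\tfrac12\left(|x|^{2H}+|y|^{2H}-|x-y|^{2H}\right)$. 3. For every such $W^H$, as $\varepsilon\downarrow 0$, $W_\varepsilon$ converges in distribution to $\beta W^H$ in $C(\mathbb R)$ equipped with the topology of uniform convergence on compact sets. -/

import Mathlib

open MeasureTheory ProbabilityTheory Filter Topology Asymptotics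

noncomputable section

/-- `C(ℝ)` carries Mathlib's compact-open topology, i.e. the topology of uniform convergence on
compact sets; we equip it with the corresponding Borel σ-algebra. -/
instance instMeasurableSpaceContinuousMapReal : MeasurableSpace C(ℝ, ℝ) := borel C(ℝ, ℝ)

instance instBorelSpaceContinuousMapReal : BorelSpace C(ℝ, ℝ) := ⟨rfl⟩

/-- The real random field `g` on `ℝ` is a (jointly measurable) centered stationary Gaussian field
of unit variance whose covariance `R_g(x) = 𝔼[g(0) g(x)]` satisfies
`R_g(x) ~ κ |x|^(-α)` as `|x| → ∞`. -/
structure IsLongRangeGaussianField {Ω : Type*} [MeasurableSpace Ω] (g : ℝ → Ω → ℝ)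
    (P : Measure Ω) (α κ : ℝ) : Prop where
  measurable : Measurable (Function.uncurry g)
  gaussian : IsGaussianProcess g P
  centered : ∀ x, ∫ ω, g x ω ∂P = 0
  /-- Strict stationarity: the law of the field is invariant under translations. -/
  stationary : ∀ h : ℝ, IdentDistrib (fun ω x => g (x + h) ω) (fun ω x => g x ω) P P
  variance_one : ∫ ω, g 0 ω ^ 2 ∂P = 1
  covariance_asymp :
    (fun x : ℝ => ∫ ω, g 0 ω * g x ω ∂P) ~[Bornology.cobounded ℝ] (fun x => κ * |x| ^ (-α))

/-- The Hermite coefficient `V_q = 𝔼[Φ(Z) H_q(Z)]` for `Z ~ N(0,1)`, where `H_q` is the `q`-th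
(probabilists') Hermite polynomial. -/
def hermiteCoeff (Φ : ℝ → ℝ) (q : ℕ) : ℝ :=
  ∫ z, Φ z * Polynomial.aeval z (Polynomial.hermite q) ∂(gaussianReal 0 1)

/-- `Φ` has Hermite rank `m`: the smallest index `q ≥ 0` with `V_q ≠ 0` is `m`. -/
def HasHermiteRank (Φ : ℝ → ℝ) (m : ℕ) : Prop :=
  IsLeast {q : ℕ | hermiteCoeff Φ q ≠ 0} m

/-- Admissible nonlinearities: `Φ` is `C²` with bounded second derivative, `𝔼[Φ(Z)²] < ∞` for
`Z ~ N(0,1)`, and `Φ` has Hermite rank one (so `𝔼[Φ(Z)] = 0` and `𝔼[Φ(Z) Z] ≠ 0`). -/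
structure IsRankOneTransform (Φ : ℝ → ℝ) : Prop where
  memLp : MemLp Φ 2 (gaussianReal 0 1)
  contDiff : ContDiff ℝ 2 Φ
  bounded_second_deriv : ∃ M : ℝ, ∀ z, |iteratedDeriv 2 Φ z| ≤ M
  rank_one : HasHermiteRank Φ 1

/-- The process `W` is a fractional Brownian motion on `ℝ` with Hurst index `H`: a centered
Gaussian process with the usual covariance. -/
structure IsFractionalBrownianMotion {Ω : Type*} [MeasurableSpace Ω] (W : ℝ → Ω → ℝ)
    (P : Measure Ω) (H : ℝ) : Prop where
  gaussian : IsGaussianProcess W P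
  centered : ∀ x, ∫ ω, W x ω ∂P = 0
  covariance : ∀ x y, ∫ ω, W x ω * W y ω ∂P =
    (1 / 2) * (|x| ^ (2 * H) + |y| ^ (2 * H) - |x - y| ^ (2 * H))

/-- The rescaled integrated potential `W_ε(x) = ε^(-α/2) ∫_0^x a(y/ε) dy`, with the usual sign
convention for `x < 0`. -/
def rescaledIntegral {Ω : Type*} (α : ℝ) (a : ℝ → Ω → ℝ) (ε x : ℝ) (ω : Ω) : ℝ :=
  ε ^ (-(α / 2)) * ∫ y in (0 : ℝ)..x, a (y / ε) ω

open Classical in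
/-- The path `x ↦ W_ε(x)` as an element of `C(ℝ)`. Whenever `y ↦ a(y, ω)` is locally integrable
the path is continuous and the first branch applies; the value `0` is only used otherwise. -/
def rescaledPath {Ω : Type*} (α : ℝ) (a : ℝ → Ω → ℝ) (ε : ℝ) (ω : Ω) : C(ℝ, ℝ) :=
  if h : Continuous (fun x => rescaledIntegral α a ε x ω) then
    ⟨fun x => rescaledIntegral α a ε x ω, h⟩
  else 0

end

/-! Split `Φ(z) = V₁ z + Ψ(z)`, where `Ψ = rankTwoPart Φ` is orthogonal to `1` and `z` in `L²` of
the standard Gaussian. The linear part carries the limit and the remainder vanishes.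

Linear part. After rescaling, the covariance `ε^(-α) R_g(w/ε)` tends to `κ|w|^(-α)` and is dominated
by a fixed multiple of `|w|^(-α)`, which is locally integrable because `α < 1`. Dominated
convergence gives the limiting variance of increments, `κ · 2/((1-α)(2-α)) · |y-x|^(2-α)`. With `2H
= 2-α` this is `κ/(H(2H-1)) · |y-x|^(2H)`, and polarisation turns it into the fractional Brownian
covariance. Integrals of `g` lie in the closed `L²` span of the field, so their finite linear
combinations are exactly Gaussian for each `ε` and only variances have to converge
(`integral_exp_mul_I_of_mem_gaussian_space`).

Remainder. Regressing one variable on the other and expanding `Ψ` to first order shows that the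
covariance of `Ψ(g(u))` and `Ψ(g(v))` is `O(R_g(v-u)²)` (`abs_integral_mul_le_of_rank_two`). The
additional factor `R_g(w/ε)` is bounded by `1` and tends to `0`, so the remainder vanishes in `L²`
for every `α` in `(0,1)`.

Tightness. The same bounds give `E|W_ε(x)-W_ε(y)|² ≤ C|x-y|^(2-α)` uniformly in `ε`. Since `2-α >
1`, Kolmogorov's criterion works with second moments alone
(`isTightMeasureSet_of_second_moment_increments`). Prokhorov's theorem and the uniqueness of laws
with given finite-dimensional characteristic functions conclude. A cluster point of the laws,
divided by `β`, is itself a fractional Brownian motion, so existence needs no separate construction.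
-/

open scoped ENNReal NNReal

/-! ### Laws on `C(ℝ)` and their finite-dimensional distributions -/

/-- Density of `ℚ` makes the map injective, and an injective Borel map out of a Polish space is a
measurable embedding (Lusin–Souslin). Measurability into `C(ℝ)` and equality of laws thereby reduce
to countably many coordinates. -/
theorem measurableEmbedding_eval_rat :
    MeasurableEmbedding (fun (w : C(ℝ, ℝ)) (q : ℚ) => w (q : ℝ)) := by
  have : PolishSpace C(ℝ, ℝ) := inferInstance
  refine Measurable.measurableEmbedding ?_ ?_
  · exact (continuous_pi fun q : ℚ => continuous_eval_const (F := C(ℝ, ℝ)) (q : ℝ)).measurable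
  · intro w w' h
    apply DFunLike.coe_injective
    exact Continuous.ext_on Rat.isDenseEmbedding_coe_real.dense w.continuous w'.continuous
      (by rintro _ ⟨q, rfl⟩; exact congrFun h q)

theorem aemeasurable_continuousMap_of_eval {Ω : Type*} [MeasurableSpace Ω] {P : Measure Ω}
    {W : Ω → C(ℝ, ℝ)} (h : ∀ x, AEMeasurable (fun ω => W ω x) P) : AEMeasurable W P :=
  (measurableEmbedding_eval_rat.aemeasurable_comp_iff).1
    (aemeasurable_pi_lambda _ fun q => h (q : ℝ))

/-- Finite linear combinations of evaluations, as a function of the path. -/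
theorem continuous_sum_eval (I : Finset ℝ) (c : ℝ → ℝ) :
    Continuous (fun w : C(ℝ, ℝ) => ∑ x ∈ I, c x * w x) := by
  fun_prop

/-- Finite measures on `C(ℝ)` are determined by the characteristic functions of their
finite-dimensional distributions. -/
theorem measure_continuousMap_ext {μ ν : Measure C(ℝ, ℝ)} [IsFiniteMeasure μ] [IsFiniteMeasure ν]
    (h : ∀ (I : Finset ℝ) (c : ℝ → ℝ),
      ∫ w : C(ℝ, ℝ), Complex.exp (((∑ x ∈ I, c x * w x : ℝ) : ℂ) * Complex.I) ∂μ =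
      ∫ w : C(ℝ, ℝ), Complex.exp (((∑ x ∈ I, c x * w x : ℝ) : ℂ) * Complex.I) ∂ν) : μ = ν := by
  have hm := measurableEmbedding_eval_rat
  set e := fun (w : C(ℝ, ℝ)) (q : ℚ) => w (q : ℝ)
  suffices hmap : μ.map e = ν.map e by
    rw [← hm.comap_map μ, hmap, hm.comap_map]
  have hproj : ∀ ρ : Measure C(ℝ, ℝ), IsProjectiveLimit (ρ.map e)
      (fun J : Finset ℚ => (ρ.map e).map J.restrict) := fun ρ J => rfl
  have : ∀ J : Finset ℚ, IsFiniteMeasure ((ν.map e).map J.restrict) := fun J => inferInstance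
  -- A finite measure on `ℚ → ℝ` is determined by its finite marginals, and each marginal by its
  -- characteristic function.
  refine IsProjectiveLimit.unique (P := fun J : Finset ℚ => (ν.map e).map J.restrict)
    (fun J => ?_) (hproj ν)
  apply Measure.ext_of_charFunDual
  ext L
  -- The coefficient at a real `x` is the value of `L` on the basis vector of the rational that
  -- casts to `x`; the default `0` is never used in the sum.
  have key : ∀ ρ : Measure C(ℝ, ℝ), charFunDual ((ρ.map e).map J.restrict) L =
      ∫ w : C(ℝ, ℝ), Complex.exp (((∑ x ∈ J.image (fun q : ℚ => (q : ℝ)),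
        (if hx : ∃ q : J, ((q : ℚ) : ℝ) = x then L (Pi.single hx.choose 1) else 0) * w x : ℝ) : ℂ)
          * Complex.I) ∂ρ := by
    intro ρ
    rw [charFunDual_apply, integral_map (by fun_prop) (by fun_prop),
      integral_map hm.measurable.aemeasurable (by fun_prop)]
    congr 1
    ext w
    congr 3
    rw [Finset.sum_image (fun a _ b _ hab => Rat.cast_injective (α := ℝ) hab), ← Finset.sum_coe_sort J]
    conv_lhs => rw [← Finset.univ_sum_single (J.restrict (e w)), map_sum]
    refine Finset.sum_congr rfl fun q _ => ?_
    have hx : ∃ q' : J, ((q' : ℚ) : ℝ) = ((q : ℚ) : ℝ) := ⟨q, rfl⟩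
    have hc : hx.choose = q := Subtype.ext (by exact_mod_cast hx.choose_spec)
    rw [dif_pos hx, hc]
    have : Pi.single (M := fun _ : J => ℝ) q (J.restrict (e w) q) =
      (w (q : ℚ) : ℝ) • Pi.single (M := fun _ : J => ℝ) q 1 := by
      rw [← Pi.single_smul]; simp [e]
    rw [this, map_smul, smul_eq_mul, mul_comm]
  rw [key, key, h]

/-- The integrand is bounded and continuous on path space. This lets weak cluster points inherit
limits of characteristic functions. -/
theorem continuous_integral_exp_sum_eval (I : Finset ℝ) (c : ℝ → ℝ) :
    Continuous (fun μ : ProbabilityMeasure C(ℝ, ℝ) =>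
      ∫ w : C(ℝ, ℝ), Complex.exp (((∑ x ∈ I, c x * w x : ℝ) : ℂ) * Complex.I)
        ∂(μ : Measure C(ℝ, ℝ))) := by
  let f : BoundedContinuousFunction C(ℝ, ℝ) ℂ :=
    BoundedContinuousFunction.ofNormedAddCommGroup
      (fun w : C(ℝ, ℝ) => Complex.exp (((∑ x ∈ I, c x * w x : ℝ) : ℂ) * Complex.I))
      (by fun_prop) 1 (fun w => by rw [Complex.norm_exp_ofReal_mul_I])
  rw [continuous_iff_continuousAt]
  intro μ
  exact (ProbabilityMeasure.tendsto_iff_forall_integral_rclike_tendsto ℂ).1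
    (tendsto_id (α := ProbabilityMeasure C(ℝ, ℝ))) f

/-! ### Chaining, compactness and Kolmogorov tightness -/

/-- Dyadic chaining: control of the dyadic increments gives a modulus of continuity. -/
theorem abs_sub_le_of_dyadic_increments {f : ℝ → ℝ} (hf : Continuous f) {r D : ℝ} (hr0 : 0 < r)
    (hr1 : r < 1) (hD : 0 ≤ D) {N : ℕ}
    (h : ∀ (n : ℕ) (k : ℤ), -(N * 2 ^ n : ℤ) ≤ k → k < N * 2 ^ n →
      |f ((k + 1 : ℤ) / 2 ^ n) - f (k / 2 ^ n)| ≤ D * r ^ n)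
    {n : ℕ} {x y : ℝ} (hx : |x| ≤ N) (hy : |y| ≤ N) (hxy : |x - y| ≤ (2 ^ n)⁻¹) :
    |f x - f y| ≤ D * (1 + 2 / (1 - r)) * r ^ n := by
  have h1r : 0 < 1 - r := by linarith
  have low : ∀ {z : ℝ} (m : ℕ), |z| ≤ N → -(N * 2 ^ m : ℤ) ≤ ⌊z * 2 ^ m⌋ := by
    intro z m hz
    rw [Int.le_floor]
    push_cast
    have := (abs_le.1 hz).1
    have h2 : (0 : ℝ) < 2 ^ m := by positivity
    nlinarith
  have high : ∀ {z : ℝ} (m : ℕ), |z| ≤ N → ⌊z * 2 ^ m⌋ ≤ (N * 2 ^ m : ℤ) := by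
    intro z m hz
    have := (abs_le.1 hz).2
    have h2 : (0 : ℝ) < 2 ^ m := by positivity
    have h3 := Int.floor_le (z * 2 ^ m)
    have h4 : ((⌊z * 2 ^ m⌋ : ℤ) : ℝ) ≤ ((N * 2 ^ m : ℤ) : ℝ) := by push_cast; nlinarith
    exact_mod_cast h4
  -- Consecutive dyadic approximations from below are equal or adjacent at the finer level, so the
  -- errors sum to a geometric series.
  have approx : ∀ {z : ℝ}, |z| ≤ N → ∀ m : ℕ,
      |f ((⌊z * 2 ^ m⌋ : ℤ) / 2 ^ m) - f z| ≤ D * r ^ m / (1 - r) := by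
    intro z hz m
    have step : ∀ m : ℕ, dist (f ((⌊z * 2 ^ m⌋ : ℤ) / 2 ^ m))
        (f ((⌊z * 2 ^ (m + 1)⌋ : ℤ) / 2 ^ (m + 1))) ≤ D * r ^ m := by
      intro m
      have hDr : D * r ^ (m + 1) ≤ D * r ^ m :=
        mul_le_mul_of_nonneg_left (pow_le_pow_of_le_one hr0.le hr1.le (Nat.le_succ m)) hD
      have ha := Int.floor_le (z * 2 ^ m)
      have hb := Int.lt_floor_add_one (z * 2 ^ m)
      have hk1 : 2 * ⌊z * 2 ^ m⌋ ≤ ⌊z * 2 ^ (m + 1)⌋ := by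
        rw [Int.le_floor]; push_cast; rw [pow_succ]; linarith
      have hk2 : ⌊z * 2 ^ (m + 1)⌋ < 2 * ⌊z * 2 ^ m⌋ + 2 := by
        rw [Int.floor_lt]; push_cast; rw [pow_succ]; linarith
      have hpt : (((⌊z * 2 ^ m⌋ : ℤ) : ℝ) / 2 ^ m)
          = ((2 * ⌊z * 2 ^ m⌋ : ℤ) : ℝ) / 2 ^ (m + 1) := by
        push_cast; rw [pow_succ]; field_simp
      have hcase : ⌊z * 2 ^ (m + 1)⌋ = 2 * ⌊z * 2 ^ m⌋ ∨
          ⌊z * 2 ^ (m + 1)⌋ = 2 * ⌊z * 2 ^ m⌋ + 1 := by omega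
      rcases hcase with hc | hc
      · rw [hpt, hc, dist_self]; positivity
      · have hl := low m hz
        have hh := high (m + 1) hz
        rw [hpt, hc, dist_comm, Real.dist_eq]
        refine (h (m + 1) (2 * ⌊z * 2 ^ m⌋) ?_ ?_).trans hDr
        · rw [pow_succ]; linarith
        · omega
    have hlim : Tendsto (fun m : ℕ => ((⌊z * 2 ^ m⌋ : ℤ) : ℝ) / 2 ^ m) atTop (𝓝 z) := by
      have h0 : Tendsto (fun m : ℕ => z - ((2 : ℝ)⁻¹) ^ m) atTop (𝓝 z) := by
        simpa using (tendsto_pow_atTop_nhds_zero_of_lt_one (r := (2 : ℝ)⁻¹)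
          (by norm_num) (by norm_num)).const_sub z
      refine tendsto_of_tendsto_of_tendsto_of_le_of_le h0 tendsto_const_nhds (fun m => ?_)
        (fun m => ?_)
      · have hb := Int.lt_floor_add_one (z * 2 ^ m)
        have h2 : (0 : ℝ) < 2 ^ m := by positivity
        simp only
        rw [inv_pow, le_div_iff₀ h2, sub_mul, inv_mul_cancel₀ h2.ne']
        linarith
      · have h2 : (0 : ℝ) < 2 ^ m := by positivity
        simp only
        rw [div_le_iff₀ h2]; exact Int.floor_le _
    have := dist_le_of_le_geometric_of_tendsto r D hr1 step
      ((hf.tendsto z).comp hlim) m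
    simpa [Real.dist_eq] using this
  wlog hle : x ≤ y generalizing x y
  · rw [abs_sub_comm]
    exact this hy hx (by rwa [abs_sub_comm]) (le_of_not_ge hle)
  -- Points at distance at most `2^(-n)` have level-`n` floors differing by at most one: this is the
  -- `1` in the constant, and the two approximation errors give `2 / (1 - r)`.
  have hmid : |f ((⌊x * 2 ^ n⌋ : ℤ) / 2 ^ n) - f ((⌊y * 2 ^ n⌋ : ℤ) / 2 ^ n)| ≤ D * r ^ n := by
    have h2 : (0 : ℝ) < 2 ^ n := by positivity
    have hk1 : ⌊x * 2 ^ n⌋ ≤ ⌊y * 2 ^ n⌋ := Int.floor_le_floor (by gcongr)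
    have hk2 : ⌊y * 2 ^ n⌋ ≤ ⌊x * 2 ^ n⌋ + 1 := by
      rw [← Int.floor_add_one]
      apply Int.floor_le_floor
      have h3 : y - x ≤ (2 ^ n)⁻¹ := by rw [abs_sub_comm, abs_of_nonneg (by linarith)] at hxy; exact hxy
      have h4 := mul_le_mul_of_nonneg_right h3 h2.le
      rw [inv_mul_cancel₀ h2.ne'] at h4
      linarith
    have hcase : ⌊y * 2 ^ n⌋ = ⌊x * 2 ^ n⌋ ∨ ⌊y * 2 ^ n⌋ = ⌊x * 2 ^ n⌋ + 1 := by omega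
    rcases hcase with hc | hc
    · rw [hc, sub_self, abs_zero]; positivity
    · have hl := low n hx
      have hh := high n hy
      rw [hc, abs_sub_comm]
      exact h n _ hl (by omega)
  have hA := approx hx n
  have hB := approx hy n
  rw [abs_sub_comm] at hA
  calc |f x - f y| ≤ |f x - f ((⌊x * 2 ^ n⌋ : ℤ) / 2 ^ n)| +
        |f ((⌊x * 2 ^ n⌋ : ℤ) / 2 ^ n) - f ((⌊y * 2 ^ n⌋ : ℤ) / 2 ^ n)| +
        |f ((⌊y * 2 ^ n⌋ : ℤ) / 2 ^ n) - f y| := by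
          refine (abs_sub_le _ (f ((⌊y * 2 ^ n⌋ : ℤ) / 2 ^ n)) _).trans ?_
          gcongr
          exact abs_sub_le _ _ _
    _ ≤ D * r ^ n / (1 - r) + D * r ^ n + D * r ^ n / (1 - r) := by gcongr
    _ = D * (1 + 2 / (1 - r)) * r ^ n := by ring

/-- Paths vanishing at `0` with prescribed local moduli of continuity form a compact set. -/
theorem isCompact_setOf_modulus {r : ℝ} (hr0 : 0 < r) (hr1 : r < 1) (M : ℕ → ℝ) :
    IsCompact {w : C(ℝ, ℝ) | w 0 = 0 ∧ ∀ (N n : ℕ) (x y : ℝ), |x| ≤ N → |y| ≤ N →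
      |x - y| ≤ (2 ^ n)⁻¹ → |w x - w y| ≤ M N * r ^ n} := by
  -- The condition is stated for arbitrary functions: it is closed for pointwise convergence and
  -- forces continuity, so the pointwise image of the set of paths is closed in a product of
  -- intervals.
  set p : (ℝ → ℝ) → Prop := fun w => w 0 = 0 ∧ ∀ (N n : ℕ) (x y : ℝ), |x| ≤ N → |y| ≤ N →
      |x - y| ≤ (2 ^ n)⁻¹ → |w x - w y| ≤ M N * r ^ n with hp
  have hequi : ∀ (x : ℝ) (N : ℕ), |x| + 1 ≤ N → ∀ ε > 0, ∃ δ > 0, ∀ w, p w →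
      ∀ y, |x - y| < δ → |w x - w y| < ε := by
    intro x N hN ε hε
    have hlim : Tendsto (fun n : ℕ => M N * r ^ n) atTop (𝓝 0) := by
      simpa using (tendsto_pow_atTop_nhds_zero_of_lt_one hr0.le hr1).const_mul (M N)
    obtain ⟨n, hn⟩ := (hlim.eventually (gt_mem_nhds hε)).exists
    refine ⟨(2 ^ n)⁻¹, by positivity, fun w hw y hy => ?_⟩
    have hle1 : ((2 : ℝ) ^ n)⁻¹ ≤ 1 := inv_le_one_of_one_le₀ (one_le_pow₀ (by norm_num))
    have hyN : |y| ≤ N := by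
      have := abs_sub_abs_le_abs_sub y x
      rw [abs_sub_comm] at this
      linarith
    exact (hw.2 N n x y (by linarith) hyN hy.le).trans_lt hn
  have hcont : ∀ w, p w → Continuous w := by
    intro w hw
    rw [Metric.continuous_iff]
    intro x ε hε
    obtain ⟨N, hN⟩ := exists_nat_ge (|x| + 1)
    obtain ⟨δ, hδ, hd⟩ := hequi x N hN ε hε
    refine ⟨δ, hδ, fun y hy => ?_⟩
    rw [Real.dist_eq, abs_sub_comm] at hy ⊢
    exact hd w hw y hy
  apply ArzelaAscoli.isCompact_of_equicontinuous
  · have himg : (ContinuousMap.toFun '' {w : C(ℝ, ℝ) | p w}) = {w : ℝ → ℝ | p w} := by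
      ext w
      constructor
      · rintro ⟨v, hv, rfl⟩; exact hv
      · intro hw; exact ⟨⟨w, hcont w hw⟩, hw, rfl⟩
    change IsCompact (ContinuousMap.toFun '' {w : C(ℝ, ℝ) | p w})
    rw [himg]
    -- Starting from `w 0 = 0`, the point `x` is reached in `m` steps of length at most `1`, each
    -- covered by the modulus at level `0`.
    have hbd : ∀ x : ℝ, ∃ B : ℝ, ∀ w, p w → |w x| ≤ B := by
      intro x
      obtain ⟨N, hN⟩ := exists_nat_ge |x|
      obtain ⟨m, hm⟩ := exists_nat_gt |x|
      have hm0 : (0 : ℝ) < m := (abs_nonneg x).trans_lt hm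
      refine ⟨m * |M N|, fun w hw => ?_⟩
      have hstep : ∀ j : ℕ, j ≤ m → |w (j / m * x)| ≤ j * |M N| := by
        intro j
        induction j with
        | zero => intro _; simp [hw.1]
        | succ j ih =>
          intro hj
          have hin : ∀ i : ℕ, i ≤ m → |(i / m * x : ℝ)| ≤ N := by
            intro i hi
            rw [abs_mul, abs_of_nonneg (by positivity)]
            have : (i : ℝ) / m ≤ 1 := by
              rw [div_le_one hm0]; exact_mod_cast hi
            nlinarith [abs_nonneg x]
          have h1 := hw.2 N 0 _ _ (hin (j + 1) hj) (hin j (by omega)) (by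
            rw [← sub_mul, ← sub_div]
            push_cast
            rw [add_sub_cancel_left, abs_mul, abs_of_nonneg (by positivity)]
            simp only [pow_zero, inv_one]
            rw [one_div, inv_mul_le_iff₀ hm0]
            linarith)
          have h2 := ih (by omega)
          have h3 : |w ((j + 1 : ℕ) / m * x)| ≤ |w ((j + 1 : ℕ) / m * x) - w (j / m * x)| +
              |w (j / m * x)| := by
            simpa using abs_add_le (w ((j + 1 : ℕ) / m * x) - w (j / m * x)) (w (j / m * x))
          have h4 := le_abs_self (M N)
          rw [pow_zero, mul_one] at h1
          push_cast at h1 h3 ⊢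
          linarith
      have := hstep m le_rfl
      rwa [div_self hm0.ne', one_mul] at this
    choose B hB using hbd
    refine IsCompact.of_isClosed_subset (isCompact_univ_pi fun x => isCompact_Icc (a := -B x)
      (b := B x)) ?_ ?_
    · simp only [hp, Set.ofPred_and, Set.ofPred_forall]
      refine IsClosed.inter ?_ ?_
      · exact isClosed_eq (by fun_prop) (by fun_prop)
      · refine isClosed_iInter fun N => isClosed_iInter fun n => isClosed_iInter fun x =>
          isClosed_iInter fun y => isClosed_iInter fun _ => isClosed_iInter fun _ =>
          isClosed_iInter fun _ => ?_
        exact isClosed_le (by fun_prop) (by fun_prop)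
    · intro w hw x _
      exact abs_le.1 (hB x w hw)
  · intro x
    rw [Metric.equicontinuousAt_iff]
    intro ε hε
    obtain ⟨N, hN⟩ := exists_nat_ge (|x| + 1)
    obtain ⟨δ, hδ, hd⟩ := hequi x N hN ε hε
    refine ⟨δ, hδ, fun y hy w => ?_⟩
    rw [Real.dist_eq, abs_sub_comm] at hy
    rw [Real.dist_eq]
    exact hd _ w.2 y hy

/-- Kolmogorov's tightness criterion on `C(ℝ)`, with second moments. -/
theorem isTightMeasureSet_of_second_moment_increments {S : Set (Measure C(ℝ, ℝ))} {C δ : ℝ}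
    (hC : 0 ≤ C) (hδ : 0 < δ) (h0 : ∀ μ ∈ S, ∀ᵐ w : C(ℝ, ℝ) ∂μ, w 0 = 0)
    (hinc : ∀ μ ∈ S, ∀ x y : ℝ, ∫⁻ w : C(ℝ, ℝ), ENNReal.ofReal ((w x - w y) ^ 2) ∂μ ≤
      ENNReal.ofReal (C * |x - y| ^ (1 + δ))) :
    IsTightMeasureSet S := by
  rw [isTightMeasureSet_iff_exists_isCompact_measure_compl_le]
  intro η hη
  -- With `2^(-δ) = r^4`, a squared level-`n` increment has mean at most `C 2^(-n) r^(4n)`.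
  -- Weighting by `r^(-2n)` and summing over `2N·2^n` intervals leaves the summable `r^(2n)`, while
  -- a bound `L` on the weighted sum gives increments at most `√L · r^n`.
  obtain ⟨r, hr0, hr1, hr⟩ : ∃ r : ℝ, 0 < r ∧ r < 1 ∧ (2 : ℝ) ^ (-δ) = r ^ 4 := by
    refine ⟨2 ^ (-(δ / 4)), by positivity, Real.rpow_lt_one_of_one_lt_of_neg (by norm_num)
      (by linarith), ?_⟩
    rw [← Real.rpow_natCast, ← Real.rpow_mul (by norm_num)]
    congr 1; push_cast; ring
  let A : ℕ → C(ℝ, ℝ) → ℝ≥0∞ := fun N w => ∑' n : ℕ,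
    ∑ k ∈ Finset.Ico (-(N * 2 ^ n : ℤ)) (N * 2 ^ n),
      ENNReal.ofReal (((r ^ 2) ^ n)⁻¹ * (w ((k + 1 : ℤ) / 2 ^ n) - w (k / 2 ^ n)) ^ 2)
  have hmeas : ∀ a x y : ℝ, Measurable (fun w : C(ℝ, ℝ) => ENNReal.ofReal (a * (w x - w y) ^ 2)) :=
    fun a x y => ENNReal.measurable_ofReal.comp (Continuous.measurable (by fun_prop))
  have hAmeas : ∀ N, Measurable (A N) := by
    intro N
    exact Measurable.tsum fun n => Finset.measurable_sum _ fun k _ => hmeas _ _ _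
  have hterm : ∀ μ ∈ S, ∀ (N n : ℕ),
      ∫⁻ w : C(ℝ, ℝ), ∑ k ∈ Finset.Ico (-(N * 2 ^ n : ℤ)) (N * 2 ^ n),
        ENNReal.ofReal (((r ^ 2) ^ n)⁻¹ * (w ((k + 1 : ℤ) / 2 ^ n) - w (k / 2 ^ n)) ^ 2) ∂μ ≤
      ENNReal.ofReal (2 * N * C * (r ^ 2) ^ n) := by
    intro μ hμ N n
    rw [lintegral_finsetSum _ (fun k _ => hmeas _ _ _)]
    have hk : ∀ k ∈ Finset.Ico (-(N * 2 ^ n : ℤ)) (N * 2 ^ n),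
        ∫⁻ w : C(ℝ, ℝ), ENNReal.ofReal (((r ^ 2) ^ n)⁻¹ *
          (w ((k + 1 : ℤ) / 2 ^ n) - w (k / 2 ^ n)) ^ 2) ∂μ ≤
        ENNReal.ofReal (((r ^ 2) ^ n)⁻¹ * (C * ((2 ^ n)⁻¹ * (r ^ 4) ^ n))) := by
      intro k _
      simp_rw [ENNReal.ofReal_mul (show (0 : ℝ) ≤ ((r ^ 2) ^ n)⁻¹ by positivity)]
      rw [lintegral_const_mul' _ _ ENNReal.ofReal_ne_top]
      gcongr
      refine (hinc μ hμ _ _).trans (le_of_eq ?_)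
      congr 2
      have : ((k + 1 : ℤ) : ℝ) / 2 ^ n - k / 2 ^ n = (2 ^ n)⁻¹ := by
        push_cast; ring
      rw [this, abs_of_nonneg (by positivity), Real.rpow_add (by positivity), Real.rpow_one, ← hr]
      congr 1
      rw [Real.inv_rpow (by positivity), ← Real.rpow_natCast, ← Real.rpow_natCast,
        ← Real.rpow_mul (by norm_num), ← Real.rpow_mul (by norm_num),
        ← Real.rpow_neg (by norm_num)]
      congr 1; ring
    refine (Finset.sum_le_sum hk).trans ?_
    rw [Finset.sum_const, Int.card_Ico, nsmul_eq_mul]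
    have hcard : ((N * 2 ^ n - -(N * 2 ^ n) : ℤ).toNat : ℝ≥0∞) = ENNReal.ofReal (2 * N * 2 ^ n) := by
      have : (N * 2 ^ n - -(N * 2 ^ n) : ℤ) = ((2 * N * 2 ^ n : ℕ) : ℤ) := by push_cast; ring
      rw [this, Int.toNat_natCast, ← ENNReal.ofReal_natCast]
      push_cast; rfl
    rw [hcard, ← ENNReal.ofReal_mul (by positivity)]
    apply ENNReal.ofReal_le_ofReal
    apply le_of_eq
    have : (r ^ 4) ^ n = (r ^ 2) ^ n * (r ^ 2) ^ n := by rw [← mul_pow]; ring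
    rw [this]
    have hr2 : (r ^ 2) ^ n ≠ 0 := by positivity
    field_simp
  have hr2 : r ^ 2 < 1 := pow_lt_one₀ hr0.le hr1 (by norm_num)
  have hAint : ∀ μ ∈ S, ∀ N, ∫⁻ w, A N w ∂μ ≤
      ENNReal.ofReal (2 * N * C * (1 - r ^ 2)⁻¹) := by
    intro μ hμ N
    simp only [A]
    rw [lintegral_tsum (fun n => (Finset.measurable_sum _ fun k _ => hmeas _ _ _).aemeasurable)]
    refine (ENNReal.tsum_le_tsum fun n => hterm μ hμ N n).trans (le_of_eq ?_)
    rw [← ENNReal.ofReal_tsum_of_nonneg (fun n => by positivity)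
      ((summable_geometric_of_lt_one (by positivity) hr2).mul_left _), tsum_mul_left,
      tsum_geometric_of_lt_one (by positivity) hr2]
  obtain ⟨η', hη'pos, hη'sum⟩ := ENNReal.exists_pos_sum_of_countable hη.ne' ℕ
  have hL : ∀ N, ∃ L : ℝ, 0 ≤ L ∧ ∀ μ ∈ S, μ {w | ENNReal.ofReal L ≤ A N w} ≤ η' N := by
    intro N
    -- Markov's inequality; the `+ 1` keeps the threshold positive even when the expectation bound
    -- is zero.
    refine ⟨(2 * N * C * (1 - r ^ 2)⁻¹ + 1) / η' N, ?_, fun μ hμ => ?_⟩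
    · have : 0 < 1 - r ^ 2 := by linarith
      positivity
    have hη0 : (0 : ℝ) < η' N := hη'pos N
    have hB : 0 < 2 * N * C * (1 - r ^ 2)⁻¹ + 1 := by
      have : 0 < 1 - r ^ 2 := by linarith
      positivity
    refine (meas_ge_le_lintegral_div (hAmeas N).aemeasurable (by simp; positivity)
      (by simp)).trans ?_
    rw [ENNReal.div_le_iff (by simp; positivity) (by simp)]
    refine (hAint μ hμ N).trans ?_
    have : ((η' N : ℝ≥0) : ℝ≥0∞) = ENNReal.ofReal (η' N : ℝ) := by simp
    rw [this, ← ENNReal.ofReal_mul hη0.le, mul_div_cancel₀ _ hη0.ne']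
    exact ENNReal.ofReal_le_ofReal (by linarith)
  choose L hL0 hL using hL
  refine ⟨_, isCompact_setOf_modulus hr0 hr1 (fun N => Real.sqrt (L N) * (1 + 2 / (1 - r))),
    fun μ hμ => ?_⟩
  have hsub : {w : C(ℝ, ℝ) | w 0 = 0 ∧ ∀ (N n : ℕ) (x y : ℝ), |x| ≤ N → |y| ≤ N →
      |x - y| ≤ (2 ^ n)⁻¹ → |w x - w y| ≤ (Real.sqrt (L N) * (1 + 2 / (1 - r))) * r ^ n}ᶜ ⊆
      {w : C(ℝ, ℝ) | ¬ w 0 = 0} ∪ ⋃ N, {w | ENNReal.ofReal (L N) ≤ A N w} := by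
    intro w hw
    by_contra hcon
    simp only [Set.mem_union, Set.mem_iUnion, Set.mem_ofPred_eq, not_or, not_exists, not_not,
      not_le] at hcon
    refine hw ⟨hcon.1, fun N n x y hx hy hxy => ?_⟩
    refine abs_sub_le_of_dyadic_increments w.continuous hr0 hr1 (Real.sqrt_nonneg _)
      (fun m k hk1 hk2 => ?_) hx hy hxy
    have h1 : ENNReal.ofReal (((r ^ 2) ^ m)⁻¹ * (w ((k + 1 : ℤ) / 2 ^ m) - w (k / 2 ^ m)) ^ 2) ≤
        A N w := by
      refine le_trans ?_ (ENNReal.le_tsum m)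
      exact Finset.single_le_sum (f := fun k : ℤ => ENNReal.ofReal (((r ^ 2) ^ m)⁻¹ *
        (w ((k + 1 : ℤ) / 2 ^ m) - w (k / 2 ^ m)) ^ 2)) (fun _ _ => zero_le)
        (Finset.mem_Ico.2 ⟨hk1, hk2⟩)
    have h2 := (ENNReal.ofReal_le_ofReal_iff (hL0 N)).1 (h1.trans (hcon.2 N).le)
    rw [inv_mul_le_iff₀ (by positivity)] at h2
    have h3 : Real.sqrt (L N) * r ^ m = Real.sqrt ((r ^ 2) ^ m * L N) := by
      rw [Real.sqrt_mul (by positivity), ← pow_mul, mul_comm 2 m, pow_mul,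
        Real.sqrt_sq (by positivity), mul_comm]
    rw [h3]
    exact Real.abs_le_sqrt h2
  refine (measure_mono hsub).trans ((measure_union_le _ _).trans ?_)
  rw [show μ {w : C(ℝ, ℝ) | ¬ w 0 = 0} = 0 from h0 μ hμ, zero_add]
  refine (measure_iUnion_le _).trans ?_
  exact (ENNReal.tsum_le_tsum fun N => hL N μ hμ).trans hη'sum.le

/-! ### Gaussian characteristic functions and a Taylor estimate -/

section Gaussian

variable {Ω : Type*} [MeasurableSpace Ω] {P : Measure Ω}

theorem ProbabilityTheory.HasGaussianLaw.integral_exp_mul_I {X : Ω → ℝ} (hX : HasGaussianLaw X P)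
    (h0 : ∫ ω, X ω ∂P = 0) :
    ∫ ω, Complex.exp (X ω * Complex.I) ∂P = Complex.exp (-((∫ ω, X ω ^ 2 ∂P : ℝ) : ℂ) / 2) := by
  have h1 : charFun (P.map X) 1 = ∫ ω, Complex.exp (X ω * Complex.I) ∂P := by
    rw [charFun_apply_real, integral_map hX.aemeasurable (by fun_prop)]
    simp
  rw [← h1, hX.map_eq_gaussianReal, charFun_gaussianReal, h0,
    variance_of_integral_eq_zero hX.aemeasurable h0,
    Real.coe_toNNReal _ (integral_nonneg fun ω => sq_nonneg _)]
  congr 1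
  push_cast
  ring

theorem norm_Lp_two_sq {Y : Ω → ℝ} (hY : MemLp Y 2 P) : ‖hY.toLp Y‖ ^ 2 = ∫ ω, Y ω ^ 2 ∂P := by
  rw [← real_inner_self_eq_norm_sq, L2.inner_def]
  refine integral_congr_ae ?_
  filter_upwards [hY.coeFn_toLp] with ω hω
  rw [hω]; simp [sq]

variable [IsProbabilityMeasure P]

theorem integral_abs_le_sqrt_integral_sq {X : Ω → ℝ} (hX : MemLp X 2 P) :
    ∫ ω, |X ω| ∂P ≤ Real.sqrt (∫ ω, X ω ^ 2 ∂P) := by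
  apply Real.le_sqrt_of_sq_le
  have h := variance_eq_sub hX.abs
  have h2 := variance_nonneg |X| P
  rw [h] at h2
  simpa using h2

theorem integrable_exp_mul_I {X : Ω → ℝ} (hX : AEStronglyMeasurable X P) :
    Integrable (fun ω => Complex.exp (X ω * Complex.I)) P := by
  refine Integrable.of_bound (C := 1) ?_ (Eventually.of_forall fun ω => ?_)
  · exact (Complex.continuous_exp.comp
      (Complex.continuous_ofReal.mul continuous_const)).comp_aestronglyMeasurable hX
  · rw [Complex.norm_exp_ofReal_mul_I]

theorem norm_exp_mul_I_sub_le (x y : ℝ) :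
    ‖Complex.exp (x * Complex.I) - Complex.exp (y * Complex.I)‖ ≤ |x - y| := by
  have : Complex.exp (x * Complex.I) - Complex.exp (y * Complex.I) =
      Complex.exp (y * Complex.I) * (Complex.exp (Complex.I * ((x - y : ℝ) : ℂ)) - 1) := by
    rw [mul_sub, ← Complex.exp_add, mul_one]
    congr 2; push_cast; ring
  rw [this, norm_mul, Complex.norm_exp_ofReal_mul_I, one_mul]
  exact Real.norm_exp_I_mul_ofReal_sub_one_le

/-- `t ↦ exp(it)` is 1-Lipschitz and the `L¹` norm is at most the `L²` norm. This serves both to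
close the Gaussian property under `L²` limits and to discard the nonlinear remainder. -/
theorem norm_integral_exp_sub_le {X Y : Ω → ℝ} (hX : MemLp X 2 P) (hY : MemLp Y 2 P) :
    ‖∫ ω, Complex.exp (X ω * Complex.I) ∂P - ∫ ω, Complex.exp (Y ω * Complex.I) ∂P‖ ≤
      Real.sqrt (∫ ω, (X ω - Y ω) ^ 2 ∂P) := by
  rw [← integral_sub (integrable_exp_mul_I hX.1) (integrable_exp_mul_I hY.1)]
  refine (norm_integral_le_integral_norm _).trans ?_
  refine le_trans (integral_mono_of_nonneg (Eventually.of_forall fun _ => norm_nonneg _)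
    ((hX.sub hY).integrable (by norm_num)).abs
    (Eventually.of_forall fun ω => norm_exp_mul_I_sub_le _ _)) ?_
  exact integral_abs_le_sqrt_integral_sq (hX.sub hY)

/-- A square integrable variable that is orthogonal to everything orthogonal to a centered Gaussian
process has a centered Gaussian characteristic function. -/
theorem integral_exp_mul_I_of_mem_gaussian_space {T : Type*} {g : T → Ω → ℝ}
    (hg : IsGaussianProcess g P) (hc : ∀ x, ∫ ω, g x ω ∂P = 0) {X : Ω → ℝ} (hX : MemLp X 2 P)
    (h : ∀ Y : Ω → ℝ, MemLp Y 2 P → (∀ x, ∫ ω, Y ω * g x ω ∂P = 0) → ∫ ω, Y ω * X ω ∂P = 0) :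
    ∫ ω, Complex.exp (X ω * Complex.I) ∂P = Complex.exp (-((∫ ω, X ω ^ 2 ∂P : ℝ) : ℂ) / 2) := by
  have hgL : ∀ x, MemLp (g x) 2 P := fun x => (hg.hasGaussianLaw_eval x).memLp_two
  let e : T → Lp ℝ 2 P := fun x => (hgL x).toLp (g x)
  let K : Submodule ℝ (Lp ℝ 2 P) := Submodule.span ℝ (Set.range e)
  have hinner : ∀ {Y Z : Ω → ℝ} (hY : MemLp Y 2 P) (hZ : MemLp Z 2 P),
      inner ℝ (hY.toLp Y) (hZ.toLp Z) = ∫ ω, Z ω * Y ω ∂P := by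
    intro Y Z hY hZ
    rw [L2.inner_def]
    refine integral_congr_ae ?_
    filter_upwards [hY.coeFn_toLp, hZ.coeFn_toLp] with ω h1 h2
    rw [h1, h2]; simp
  -- The hypothesis places `X` in the double orthogonal complement of the span of the field, which
  -- is its closure.
  have hmem : hX.toLp X ∈ K.topologicalClosure := by
    rw [← Submodule.orthogonal_orthogonal_eq_closure, Submodule.mem_orthogonal']
    intro Y hY
    have hYL := Lp.memLp Y
    have hYe : Y = hYL.toLp Y := (Lp.toLp_coeFn Y hYL).symm
    rw [hYe, hinner]
    refine h _ hYL fun x => ?_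
    rw [Submodule.mem_orthogonal] at hY
    have := hY (e x) (Submodule.subset_span ⟨x, rfl⟩)
    rw [hYe, hinner] at this
    exact this
  -- The identity between characteristic function and variance is closed in `L²` and holds on the
  -- span, where every element is a centered Gaussian variable.
  have hclosed : IsClosed {Y : Lp ℝ 2 P | ∫ ω, Complex.exp (Y ω * Complex.I) ∂P =
      Complex.exp (-((‖Y‖ ^ 2 : ℝ) : ℂ) / 2)} := by
    refine isClosed_eq ?_ (by fun_prop)
    refine LipschitzWith.continuous (K := 1) (LipschitzWith.of_dist_le_mul fun Y Z => ?_)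
    rw [dist_eq_norm, dist_eq_norm, NNReal.coe_one, one_mul]
    refine (norm_integral_exp_sub_le (Lp.memLp Y) (Lp.memLp Z)).trans (le_of_eq ?_)
    rw [← Real.sqrt_sq (norm_nonneg (Y - Z))]
    congr 1
    rw [← real_inner_self_eq_norm_sq, L2.inner_def]
    refine integral_congr_ae ?_
    filter_upwards [Lp.coeFn_sub Y Z] with ω hω
    rw [hω]; simp [sq]
  have hspan : (K : Set (Lp ℝ 2 P)) ⊆ {Y : Lp ℝ 2 P | ∫ ω, Complex.exp (Y ω * Complex.I) ∂P =
      Complex.exp (-((‖Y‖ ^ 2 : ℝ) : ℂ) / 2)} := by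
    intro Y hY
    obtain ⟨c, rfl⟩ := (Finsupp.mem_span_range_iff_exists_finsupp).1 hY
    have hZL : MemLp (fun ω => ∑ x ∈ c.support, c x • g x ω) 2 P :=
      memLp_finsetSum _ fun x _ => (hgL x).const_smul (c x)
    have hZ : (c.sum fun x a => a • e x) = hZL.toLp _ := by
      rw [Finsupp.sum]
      have : ∀ x, c x • e x = ((hgL x).const_smul (c x)).toLp (fun ω => c x • g x ω) := fun x =>
        (MemLp.toLp_const_smul (c x) (hgL x)).symm
      simp_rw [this]
      apply Lp.ext
      refine (Lp.coeFn_finsetSum _ _).trans ?_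
      have hall : ∀ᵐ ω ∂P, ∀ x ∈ c.support, (((hgL x).const_smul (c x)).toLp
          (fun ω => c x • g x ω) : Ω → ℝ) ω = c x • g x ω := by
        rw [Filter.eventually_all_finset]
        intro x _
        exact MemLp.coeFn_toLp ((hgL x).const_smul (c x))
      filter_upwards [hall, hZL.coeFn_toLp] with ω h1 h2
      rw [h2, Finset.sum_apply]
      exact Finset.sum_congr rfl h1
    have hG : HasGaussianLaw (fun ω => ∑ x ∈ c.support, c x • g x ω) P :=
      (hg.smul c).hasGaussianLaw_fun_sum
    have hG0 : ∫ ω, ∑ x ∈ c.support, c x • g x ω ∂P = 0 := by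
      have hi : ∀ x ∈ c.support, Integrable (fun ω => c x • g x ω) P := fun x _ =>
        ((hgL x).const_smul (c x)).integrable (by norm_num)
      rw [integral_finsetSum _ hi]
      simp [integral_const_mul, hc]
    simp only [Set.mem_ofPred_eq]
    rw [hZ, norm_Lp_two_sq, ← hG.integral_exp_mul_I hG0]
    refine integral_congr_ae ?_
    filter_upwards [hZL.coeFn_toLp] with ω hω
    rw [hω]
  have hXF := hclosed.closure_subset_iff.2 hspan hmem
  simp only [Set.mem_ofPred_eq] at hXF
  rw [norm_Lp_two_sq] at hXF
  rw [← hXF]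
  refine integral_congr_ae ?_
  filter_upwards [hX.coeFn_toLp] with ω hω
  rw [hω]

/-- First-order Taylor estimate for a function with Lipschitz derivative. -/
theorem abs_taylor_one_le {Ψ : ℝ → ℝ} {M : ℝ} (hd : Differentiable ℝ Ψ)
    (hM : ∀ x y, |deriv Ψ x - deriv Ψ y| ≤ M * |x - y|) (u h : ℝ) :
    |Ψ (u + h) - Ψ u - h * deriv Ψ u| ≤ M * h ^ 2 := by
  have hM0 : 0 ≤ M := by simpa using (abs_nonneg _).trans (hM 1 0)
  -- On the segment from `0` to `h` this derivative is at most `M|h|`, so the mean value inequality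
  -- suffices.
  have hder : ∀ k, HasDerivAt (fun k => Ψ (u + k) - k * deriv Ψ u)
      (deriv Ψ (u + k) - deriv Ψ u) k := by
    intro k
    have h1 := (hd (u + k)).hasDerivAt.comp_const_add u k
    have h2 := (hasDerivAt_id k).mul_const (deriv Ψ u)
    rw [one_mul] at h2
    exact h1.sub h2
  have := Convex.norm_image_sub_le_of_norm_hasDerivWithin_le (s := Set.uIcc 0 h) (x := 0) (y := h)
    (C := M * |h|) (fun k _ => (hder k).hasDerivWithinAt) (fun k hk => by
      refine (hM _ _).trans ?_
      rw [add_sub_cancel_left]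
      have := Set.abs_sub_left_of_mem_uIcc hk
      simp only [sub_zero] at this
      gcongr) (convex_uIcc 0 h) Set.left_mem_uIcc Set.right_mem_uIcc
  simp only [Real.norm_eq_abs, add_zero, zero_mul, sub_zero] at this
  calc |Ψ (u + h) - Ψ u - h * deriv Ψ u| = |Ψ (u + h) - h * deriv Ψ u - Ψ u| := by ring_nf
    _ ≤ M * |h| * |h| := this
    _ = M * h ^ 2 := by rw [mul_assoc, abs_mul_abs_self, sq]

end Gaussian

/-! ### Quadratic decay of covariances for Hermite rank at least two -/

section RankTwo

variable {Ω : Type*} [MeasurableSpace Ω] {P : Measure Ω}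

/-- A `C¹` function with Lipschitz derivative, orthogonal to constants and linear functions in
`L²` of the standard Gaussian, has covariance quadratic in the correlation. -/
theorem abs_integral_mul_le_of_rank_two {X Y : Ω → ℝ}
    (hXY : HasGaussianLaw (fun ω => (X ω, Y ω)) P)
    (hX0 : ∫ ω, X ω ∂P = 0) (hX1 : ∫ ω, X ω ^ 2 ∂P = 1)
    (hXlaw : P.map X = gaussianReal 0 1) (hYlaw : P.map Y = gaussianReal 0 1)
    {Ψ : ℝ → ℝ} {M : ℝ} (hd : Differentiable ℝ Ψ)
    (hM : ∀ x y, |deriv Ψ x - deriv Ψ y| ≤ M * |x - y|)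
    (hL : MemLp Ψ 2 (gaussianReal 0 1))
    (h0 : ∫ z, Ψ z ∂(gaussianReal 0 1) = 0) (h1 : ∫ z, Ψ z * z ∂(gaussianReal 0 1) = 0) :
    |∫ ω, Ψ (X ω) * Ψ (Y ω) ∂P| ≤
      (M * ∫ z, |Ψ z| * z ^ 2 ∂(gaussianReal 0 1)) * (∫ ω, X ω * Y ω ∂P) ^ 2 := by
  have : IsProbabilityMeasure P := hXY.isProbabilityMeasure
  set ρ := ∫ ω, X ω * Y ω ∂P with hρ
  have hXg : HasGaussianLaw X P := hXY.fst
  have hYg : HasGaussianLaw Y P := hXY.snd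
  have hXU : HasGaussianLaw (fun ω => (X ω, Y ω - ρ * X ω)) P :=
    hXY.map_fun ((ContinuousLinearMap.fst ℝ ℝ ℝ).prod
      (ContinuousLinearMap.snd ℝ ℝ ℝ - ρ • ContinuousLinearMap.fst ℝ ℝ ℝ))
  -- The regression residual `U = Y - ρX` is uncorrelated with `X`, hence independent of it by joint
  -- Gaussianity.
  set U : Ω → ℝ := fun ω => Y ω - ρ * X ω with hU
  have hUg : HasGaussianLaw U P := hXU.snd
  have hXm := hXg.aemeasurable
  have hYm := hYg.aemeasurable
  have hUm := hUg.aemeasurable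
  have hX2 := hXg.memLp_two
  have hY2 := hYg.memLp_two
  have hU2 := hUg.memLp_two
  have hind : IndepFun X U P := by
    apply hXU.indepFun_of_covariance_eq_zero
    rw [covariance_eq_sub hX2 hU2]
    have : ∫ ω, (X * U) ω ∂P = 0 := by
      have : ∀ ω, (X * U) ω = X ω * Y ω - ρ * X ω ^ 2 := fun ω => by
        simp only [Pi.mul_apply, hU]; ring
      simp_rw [this]
      have hXYi : Integrable (fun ω => X ω * Y ω) P := hX2.integrable_mul hY2
      rw [integral_sub hXYi (hX2.integrable_sq.const_mul ρ),
        integral_const_mul, hX1]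
      simp [← hρ]
    rw [this, hX0]; ring
  have hΨm : Measurable Ψ := hd.continuous.measurable
  have hΨ'm : Measurable (deriv Ψ) := measurable_deriv Ψ
  have hΨX : MemLp (fun ω => Ψ (X ω)) 2 P := by
    rw [← hXlaw] at hL; exact hL.comp_of_map hXm
  have hΨY : MemLp (fun ω => Ψ (Y ω)) 2 P := by
    rw [← hYlaw] at hL; exact hL.comp_of_map hYm
  have hXsq : MemLp (fun ω => X ω ^ 2) 2 P := by
    rw [memLp_two_iff_integrable_sq (by fun_prop)]
    have h4 := (hXg.memLp (p := (4 : ℕ)) (by simp)).integrable_norm_pow (by norm_num)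
    refine h4.congr (Eventually.of_forall fun ω => ?_)
    simp only [Real.norm_eq_abs]
    rw [← pow_mul, Even.pow_abs (by decide)]
  have hΨXi : Integrable (fun ω => Ψ (X ω)) P := hΨX.integrable (by norm_num)
  have hΨXX : Integrable (fun ω => Ψ (X ω) * X ω) P := hΨX.integrable_mul hX2
  have hUi : Integrable U P := hU2.integrable (by norm_num)
  have hΨU' : Integrable (fun ω => deriv Ψ (U ω)) P := by
    refine Integrable.mono' ((integrable_const |deriv Ψ 0|).add (hUi.abs.const_mul M))
      (hΨ'm.comp_aemeasurable hUm).aestronglyMeasurable (Eventually.of_forall fun ω => ?_)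
    have h3 := hM (U ω) 0
    have h4 := abs_sub_abs_le_abs_sub (deriv Ψ (U ω)) (deriv Ψ 0)
    rw [sub_zero] at h3
    simp only [Pi.add_apply, Real.norm_eq_abs]
    linarith
  -- `U` is not standard normal in general, so integrability comes from the quadratic growth of `Ψ`
  -- instead of `hL`.
  have hΨU : Integrable (fun ω => Ψ (U ω)) P := by
    refine Integrable.mono' (((integrable_const |Ψ 0|).add
      (hUi.abs.mul_const |deriv Ψ 0|)).add (hU2.integrable_sq.const_mul M))
      (hΨm.comp_aemeasurable hUm).aestronglyMeasurable (Eventually.of_forall fun ω => ?_)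
    have h3 := abs_taylor_one_le hd hM 0 (U ω)
    rw [zero_add, sub_sub] at h3
    have h4 := abs_sub_abs_le_abs_sub (Ψ (U ω)) (Ψ 0 + U ω * deriv Ψ 0)
    have h5 := abs_add_le (Ψ 0) (U ω * deriv Ψ 0)
    rw [abs_mul] at h5
    simp only [Pi.add_apply, Real.norm_eq_abs]
    linarith
  have hprod1 : Integrable (fun ω => Ψ (X ω) * Ψ (U ω)) P :=
    (hind.comp hΨm hΨm).integrable_mul hΨXi hΨU
  have hindX : IndepFun (fun ω => Ψ (X ω) * X ω) (fun ω => deriv Ψ (U ω)) P :=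
    hind.comp (φ := fun x => Ψ x * x) (ψ := deriv Ψ) (by fun_prop) hΨ'm
  have hprod2 : Integrable (fun ω => (Ψ (X ω) * X ω) * deriv Ψ (U ω)) P :=
    hindX.integrable_mul hΨXX hΨU'
  have hE0 : ∫ ω, Ψ (X ω) ∂P = 0 := by
    rw [← h0, ← hXlaw, integral_map hXm hΨm.aestronglyMeasurable]
  have hE1 : ∫ ω, Ψ (X ω) * X ω ∂P = 0 := by
    rw [← h1, ← hXlaw, integral_map hXm (by fun_prop)]
  have hz1 : ∫ ω, Ψ (X ω) * Ψ (U ω) ∂P = 0 := by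
    have := (hind.comp hΨm hΨm).integral_mul_eq_mul_integral
      hΨXi.aestronglyMeasurable hΨU.aestronglyMeasurable
    simp only [Pi.mul_apply, Function.comp_apply] at this
    rw [this, hE0, zero_mul]
  have hz2 : ∫ ω, (Ψ (X ω) * X ω) * deriv Ψ (U ω) ∂P = 0 := by
    have := hindX.integral_mul_eq_mul_integral
      hΨXX.aestronglyMeasurable hΨU'.aestronglyMeasurable
    simp only [Pi.mul_apply] at this
    rw [this, hE1, zero_mul]
  -- By independence and the two orthogonality relations, the zeroth- and first-order Taylor terms
  -- of `Ψ(U + ρX)` at `U` contribute nothing; only the remainder, at most `M ρ² X²`, survives.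
  have hsub : ∫ ω, Ψ (X ω) * Ψ (Y ω) ∂P =
      ∫ ω, Ψ (X ω) * (Ψ (Y ω) - Ψ (U ω) - (ρ * X ω) * deriv Ψ (U ω)) ∂P := by
    have heq : ∀ ω, Ψ (X ω) * (Ψ (Y ω) - Ψ (U ω) - (ρ * X ω) * deriv Ψ (U ω)) =
        Ψ (X ω) * Ψ (Y ω) - Ψ (X ω) * Ψ (U ω) - ρ * ((Ψ (X ω) * X ω) * deriv Ψ (U ω)) :=
      fun ω => by ring
    simp_rw [heq]
    have hprod0 : Integrable (fun ω => Ψ (X ω) * Ψ (Y ω)) P := hΨX.integrable_mul hΨY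
    have hprod : Integrable (fun ω => Ψ (X ω) * Ψ (Y ω) - Ψ (X ω) * Ψ (U ω)) P := hprod0.sub hprod1
    rw [integral_sub hprod (hprod2.const_mul ρ), integral_sub hprod0 hprod1, integral_const_mul, hz1, hz2]
    ring
  have hmom : ∫ z, |Ψ z| * z ^ 2 ∂(gaussianReal 0 1) = ∫ ω, |Ψ (X ω)| * X ω ^ 2 ∂P := by
    rw [← hXlaw, integral_map hXm (by fun_prop)]
  rw [hsub, hmom]
  have hint : Integrable (fun ω => |Ψ (X ω)| * X ω ^ 2) P := hΨX.abs.integrable_mul hXsq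
  calc |∫ ω, Ψ (X ω) * (Ψ (Y ω) - Ψ (U ω) - (ρ * X ω) * deriv Ψ (U ω)) ∂P|
      ≤ ∫ ω, |Ψ (X ω) * (Ψ (Y ω) - Ψ (U ω) - (ρ * X ω) * deriv Ψ (U ω))| ∂P :=
        abs_integral_le_integral_abs
    _ ≤ ∫ ω, (M * ρ ^ 2) * (|Ψ (X ω)| * X ω ^ 2) ∂P := by
        refine integral_mono_of_nonneg (Eventually.of_forall fun _ => abs_nonneg _)
          (hint.const_mul _) (Eventually.of_forall fun ω => ?_)
        have h3 := abs_taylor_one_le hd hM (U ω) (ρ * X ω)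
        rw [show U ω + ρ * X ω = Y ω by simp [hU]] at h3
        simp only
        rw [abs_mul]
        calc |Ψ (X ω)| * |Ψ (Y ω) - Ψ (U ω) - (ρ * X ω) * deriv Ψ (U ω)|
            ≤ |Ψ (X ω)| * (M * (ρ * X ω) ^ 2) := by gcongr
          _ = (M * ρ ^ 2) * (|Ψ (X ω)| * X ω ^ 2) := by ring
    _ = _ := by rw [integral_const_mul]; ring

end RankTwo

/-! ### Fubini for integrated `L²`-bounded processes -/

section SecondMoments

variable {Ω : Type*} [MeasurableSpace Ω] {P : Measure Ω}

theorem integral_abs_mul_le {X Y : Ω → ℝ} (hX : MemLp X 2 P) (hY : MemLp Y 2 P) :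
    ∫ ω, |X ω * Y ω| ∂P ≤ ∫ ω, X ω ^ 2 ∂P + ∫ ω, Y ω ^ 2 ∂P := by
  rw [← integral_add hX.integrable_sq hY.integrable_sq]
  refine integral_mono (hX.integrable_mul hY).abs (hX.integrable_sq.add hY.integrable_sq)
    fun ω => ?_
  simp only
  rw [abs_mul]
  have h := two_mul_le_add_sq |X ω| |Y ω|
  rw [sq_abs, sq_abs] at h
  have := mul_nonneg (abs_nonneg (X ω)) (abs_nonneg (Y ω))
  linarith

variable [IsProbabilityMeasure P]

theorem integrable_prod_of_integral_norm_le {S : Type*} [MeasurableSpace S] {μ : Measure S}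
    [IsFiniteMeasure μ] {f : Ω × S → ℝ} (hf : AEStronglyMeasurable f (P.prod μ)) {B : ℝ}
    (hi : ∀ s, Integrable (fun ω => f (ω, s)) P) (hB : ∀ s, ∫ ω, |f (ω, s)| ∂P ≤ B) :
    Integrable f (P.prod μ) := by
  rw [integrable_prod_iff' hf]
  refine ⟨Eventually.of_forall hi, ?_⟩
  refine Integrable.of_bound (C := B) ?_ (Eventually.of_forall fun s => ?_)
  · exact hf.norm.prod_swap.integral_prod_right'
  · rw [Real.norm_of_nonneg (integral_nonneg fun _ => norm_nonneg _)]
    exact hB s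

variable {b : ℝ → Ω → ℝ} {B : ℝ} {μ : Measure ℝ} [IsFiniteMeasure μ]

theorem integrable_mul_prod_of_sq_le (hb : Measurable (Function.uncurry b))
    (hL : ∀ u, MemLp (b u) 2 P) (hB : ∀ u, ∫ ω, b u ω ^ 2 ∂P ≤ B) {Y : Ω → ℝ}
    (hY : MemLp Y 2 P) : Integrable (fun p : Ω × ℝ => Y p.1 * b p.2 p.1) (P.prod μ) := by
  refine integrable_prod_of_integral_norm_le (B := ∫ ω, Y ω ^ 2 ∂P + B) ?_
    (fun u => hY.integrable_mul (hL u)) (fun u => ?_)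
  · exact hY.1.comp_fst.mul (hb.comp measurable_swap).aestronglyMeasurable
  · exact (integral_abs_mul_le hY (hL u)).trans (by gcongr; exact hB u)

theorem integrable_mul_mul_prod_of_sq_le (hb : Measurable (Function.uncurry b))
    (hL : ∀ u, MemLp (b u) 2 P) (hB : ∀ u, ∫ ω, b u ω ^ 2 ∂P ≤ B) :
    Integrable (fun p : Ω × (ℝ × ℝ) => b p.2.1 p.1 * b p.2.2 p.1) (P.prod (μ.prod μ)) := by
  refine integrable_prod_of_integral_norm_le (B := B + B) ?_
    (fun z => (hL z.1).integrable_mul (hL z.2)) (fun z => ?_)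
  · refine Measurable.aestronglyMeasurable ?_
    exact (hb.comp (f := fun p : Ω × (ℝ × ℝ) => (p.2.1, p.1)) (by fun_prop)).mul
      (hb.comp (f := fun p : Ω × (ℝ × ℝ) => (p.2.2, p.1)) (by fun_prop))
  · exact (integral_abs_mul_le (hL z.1) (hL z.2)).trans (add_le_add (hB z.1) (hB z.2))

theorem ae_integrable_of_sq_le (hb : Measurable (Function.uncurry b))
    (hL : ∀ u, MemLp (b u) 2 P) (hB : ∀ u, ∫ ω, b u ω ^ 2 ∂P ≤ B) :
    ∀ᵐ ω ∂P, Integrable (fun u => b u ω) μ := by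
  have := (integrable_mul_prod_of_sq_le (μ := μ) hb hL hB
    (memLp_const (1 : ℝ) (μ := P))).prod_right_ae
  simpa using this

theorem memLp_two_integral_of_sq_le (hb : Measurable (Function.uncurry b))
    (hL : ∀ u, MemLp (b u) 2 P) (hB : ∀ u, ∫ ω, b u ω ^ 2 ∂P ≤ B) :
    MemLp (fun ω => ∫ u, b u ω ∂μ) 2 P := by
  have hm : Measurable fun ω => ∫ u, b u ω ∂μ :=
    ((hb.comp measurable_swap).stronglyMeasurable.integral_prod_right' (ν := μ)).measurable
  rw [memLp_two_iff_integrable_sq hm.aestronglyMeasurable]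
  have := (integrable_mul_mul_prod_of_sq_le (μ := μ) hb hL hB).integral_prod_left
  refine this.congr (Eventually.of_forall fun ω => ?_)
  simp only
  rw [integral_prod_mul (fun u => b u ω) (fun u => b u ω), sq]

/-- The second moment of an integrated process is the integral of its covariance. -/
theorem integral_sq_integral_eq (hb : Measurable (Function.uncurry b))
    (hL : ∀ u, MemLp (b u) 2 P) (hB : ∀ u, ∫ ω, b u ω ^ 2 ∂P ≤ B) :
    ∫ ω, (∫ u, b u ω ∂μ) ^ 2 ∂P = ∫ z : ℝ × ℝ, ∫ ω, b z.1 ω * b z.2 ω ∂P ∂(μ.prod μ) := by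
  rw [integral_integral_swap (f := fun (z : ℝ × ℝ) ω => b z.1 ω * b z.2 ω)
    (integrable_mul_mul_prod_of_sq_le (μ := μ) hb hL hB).swap]
  refine integral_congr_ae (Eventually.of_forall fun ω => ?_)
  simp only
  rw [integral_prod_mul (fun u => b u ω) (fun u => b u ω), sq]

/-- Fubini against a fixed square integrable `Y`: anything orthogonal to the process is orthogonal
to its integrals, which places these in the closed span. -/
theorem integral_mul_integral_eq (hb : Measurable (Function.uncurry b))
    (hL : ∀ u, MemLp (b u) 2 P) (hB : ∀ u, ∫ ω, b u ω ^ 2 ∂P ≤ B) {Y : Ω → ℝ}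
    (hY : MemLp Y 2 P) :
    ∫ ω, Y ω * ∫ u, b u ω ∂μ ∂P = ∫ u, ∫ ω, Y ω * b u ω ∂P ∂μ := by
  rw [integral_integral_swap (f := fun u ω => Y ω * b u ω)
    (integrable_mul_prod_of_sq_le (μ := μ) hb hL hB hY).swap]
  simp_rw [integral_const_mul]

end SecondMoments

/-! ### Integrals of the Riesz kernel -/

section RieszKernel

variable {α : ℝ}

theorem intervalIntegrable_abs_rpow_neg (hα : α < 1) (c d : ℝ) :
    IntervalIntegrable (fun w : ℝ => |w| ^ (-α)) volume c d := by
  have hpos : ∀ e : ℝ, 0 ≤ e → IntervalIntegrable (fun w : ℝ => |w| ^ (-α)) volume 0 e := by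
    intro e he
    refine (intervalIntegral.intervalIntegrable_rpow' (r := -α) (by linarith)).congr ?_
    intro w hw
    rw [Set.uIoc_of_le he] at hw
    exact congrArg (· ^ (-α)) (abs_of_pos hw.1).symm
  have hall : ∀ e : ℝ, IntervalIntegrable (fun w : ℝ => |w| ^ (-α)) volume 0 e := by
    intro e
    rcases le_total 0 e with he | he
    · exact hpos e he
    · have := (hpos (-e) (by linarith)).comp_sub_left 0
      simpa using this
  exact (hall c).symm.trans (hall d)

theorem integral_abs_rpow_neg (hα : α < 1) {e : ℝ} (he : 0 ≤ e) :
    ∫ w in (0 : ℝ)..e, |w| ^ (-α) = e ^ (1 - α) / (1 - α) := by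
  have : ∫ w in (0 : ℝ)..e, |w| ^ (-α) = ∫ w in (0 : ℝ)..e, w ^ (-α) := by
    refine intervalIntegral.integral_congr fun w hw => ?_
    rw [Set.uIcc_of_le he] at hw
    rw [abs_of_nonneg hw.1]
  rw [this, integral_rpow (Or.inl (by linarith)), Real.zero_rpow (by linarith), sub_zero]
  ring_nf

theorem integral_abs_sub_rpow_neg (hα : α < 1) {x y u : ℝ} (hx : x ≤ u) (hy : u ≤ y) :
    ∫ v in Set.Ioc x y, |v - u| ^ (-α) =
      ((u - x) ^ (1 - α) + (y - u) ^ (1 - α)) / (1 - α) := by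
  rw [← intervalIntegral.integral_of_le (hx.trans hy),
    intervalIntegral.integral_comp_sub_right (fun w => |w| ^ (-α)) u,
    ← intervalIntegral.integral_add_adjacent_intervals (b := 0)
      (intervalIntegrable_abs_rpow_neg hα _ _) (intervalIntegrable_abs_rpow_neg hα _ _),
    integral_abs_rpow_neg hα (by linarith : 0 ≤ y - u)]
  have : ∫ w in (x - u)..0, |w| ^ (-α) = ∫ w in (0 : ℝ)..(u - x), |w| ^ (-α) := by
    have := intervalIntegral.integral_comp_neg (a := 0) (b := u - x) (fun w => |w| ^ (-α))
    simp only [abs_neg, neg_sub, neg_zero] at this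
    exact this.symm
  rw [this, integral_abs_rpow_neg hα (by linarith)]
  ring

theorem integrable_abs_sub_rpow_neg (hα : α < 1) (x y : ℝ) :
    Integrable (fun z : ℝ × ℝ => |z.2 - z.1| ^ (-α))
      ((volume.restrict (Set.Ioc x y)).prod (volume.restrict (Set.Ioc x y))) := by
  rcases lt_or_ge y x with hyx | hxy
  · simp [Set.Ioc_eq_empty (not_lt.2 hyx.le)]
  have hm : Measurable (fun z : ℝ × ℝ => |z.2 - z.1| ^ (-α)) := by fun_prop
  rw [integrable_prod_iff hm.aestronglyMeasurable]
  constructor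
  · refine Eventually.of_forall fun u => ?_
    have := (intervalIntegrable_abs_rpow_neg hα (x - u) (y - u)).comp_sub_right u
    simp only [sub_add_cancel] at this
    exact (intervalIntegrable_iff_integrableOn_Ioc_of_le hxy).1 this
  · have h : ∀ u ∈ Set.Ioc x y, ∫ v in Set.Ioc x y, ‖|v - u| ^ (-α)‖ =
        ((u - x) ^ (1 - α) + (y - u) ^ (1 - α)) / (1 - α) := by
      intro u hu
      rw [← integral_abs_sub_rpow_neg hα hu.1.le hu.2]
      congr 1
      ext v
      rw [Real.norm_of_nonneg (by positivity)]
    refine Integrable.congr (f := fun u => ((u - x) ^ (1 - α) + (y - u) ^ (1 - α)) / (1 - α)) ?_ ?_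
    · refine Continuous.integrableOn_Ioc ?_
      refine Continuous.div_const (Continuous.add ?_ ?_) _
      · exact (Real.continuous_rpow_const (by linarith)).comp (by fun_prop)
      · exact (Real.continuous_rpow_const (by linarith)).comp (by fun_prop)
    · filter_upwards [ae_restrict_mem measurableSet_Ioc] with u hu using (h u hu).symm

/-- Source of the normalisation of the limit: for `H = 1 - α/2` the constant equals `1/(H(2H-1))`
and the exponent equals `2H`. -/
theorem integral_abs_sub_rpow_neg_prod (hα : α < 1) {x y : ℝ} (hxy : x ≤ y) :
    ∫ z : ℝ × ℝ, |z.2 - z.1| ^ (-α)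
      ∂((volume.restrict (Set.Ioc x y)).prod (volume.restrict (Set.Ioc x y))) =
      2 / ((1 - α) * (2 - α)) * (y - x) ^ (2 - α) := by
  rw [integral_prod _ (integrable_abs_sub_rpow_neg hα x y)]
  have h : ∀ u ∈ Set.Ioc x y, ∫ v in Set.Ioc x y, |v - u| ^ (-α) =
      ((u - x) ^ (1 - α) + (y - u) ^ (1 - α)) / (1 - α) := fun u hu =>
    integral_abs_sub_rpow_neg hα hu.1.le hu.2
  simp only
  rw [setIntegral_congr_fun measurableSet_Ioc h, ← intervalIntegral.integral_of_le hxy,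
    intervalIntegral.integral_div, intervalIntegral.integral_add,
    intervalIntegral.integral_comp_sub_right (fun w => w ^ (1 - α)) x,
    intervalIntegral.integral_comp_sub_left (fun w => w ^ (1 - α)) y, sub_self, sub_self,
    integral_rpow (Or.inl (by linarith)), Real.zero_rpow (by linarith),
    show 1 - α + 1 = 2 - α by ring]
  · have h1 : 1 - α ≠ 0 := by linarith
    have h2 : 2 - α ≠ 0 := by linarith
    field_simp
    ring
  · exact ((Real.continuous_rpow_const (by linarith)).comp (by fun_prop)).intervalIntegrable _ _
  · exact ((Real.continuous_rpow_const (by linarith)).comp (by fun_prop)).intervalIntegrable _ _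

/-- For `α ≠ 0` the expression `|w| ^ (-α)` has the default value `0` at `w = 0`, so a positive
variance cannot be dominated there; the diagonal is a null set and can be ignored. -/
theorem ae_prod_restrict_ne (s t : Set ℝ) :
    ∀ᵐ z : ℝ × ℝ ∂((volume.restrict s).prod (volume.restrict t)), z.2 - z.1 ≠ 0 := by
  have hm : MeasurableSet {z : ℝ × ℝ | z.2 - z.1 ≠ 0} :=
    (measurableSet_eq_fun (by fun_prop) (by fun_prop)).compl
  rw [Measure.ae_prod_iff_ae_ae hm]
  refine Eventually.of_forall fun u => ae_restrict_of_ae ?_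
  filter_upwards [compl_mem_ae_iff.2 (measure_singleton u)] with v hv
  exact sub_ne_zero.2 hv

/-- Kernels dominated by, and asymptotic to a multiple of, the Riesz kernel. -/
theorem tendsto_integral_kernel {ι : Type*} {l : Filter ι} [l.IsCountablyGenerated]
    (hα : α < 1) {x y : ℝ} (hxy : x ≤ y) {r : ι → ℝ → ℝ} {C c : ℝ}
    (hm : ∀ i, Measurable (r i)) (hC : ∀ᶠ i in l, ∀ w, w ≠ 0 → |r i w| ≤ C * |w| ^ (-α))
    (hlim : ∀ w, w ≠ 0 → Tendsto (fun i => r i w) l (𝓝 (c * |w| ^ (-α)))) :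
    Tendsto (fun i => ∫ z : ℝ × ℝ, r i (z.2 - z.1)
      ∂((volume.restrict (Set.Ioc x y)).prod (volume.restrict (Set.Ioc x y)))) l
      (𝓝 (c * (2 / ((1 - α) * (2 - α)) * (y - x) ^ (2 - α)))) := by
  rw [← integral_abs_sub_rpow_neg_prod hα hxy, ← integral_const_mul]
  refine tendsto_integral_filter_of_dominated_convergence
    (fun z : ℝ × ℝ => C * |z.2 - z.1| ^ (-α)) ?_ ?_ ?_ ?_
  · exact Eventually.of_forall fun i => ((hm i).comp (by fun_prop)).aestronglyMeasurable
  · filter_upwards [hC] with i hi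
    filter_upwards [ae_prod_restrict_ne (Set.Ioc x y) (Set.Ioc x y)] with z hz
    exact hi _ hz
  · exact (integrable_abs_sub_rpow_neg hα x y).const_mul C
  · filter_upwards [ae_prod_restrict_ne (Set.Ioc x y) (Set.Ioc x y)] with z hz
    exact hlim _ hz

end RieszKernel

/-! ### Rescaled integrals and second moments of their increments -/

section Rescaled

theorem MeasureTheory.LocallyIntegrable.intervalIntegrable_comp_div {f : ℝ → ℝ}
    (hf : LocallyIntegrable f volume) (ε x y : ℝ) :
    IntervalIntegrable (fun u => f (u / ε)) volume x y := by
  rcases eq_or_ne ε 0 with rfl | hε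
  · simp
  · have h0 : IntervalIntegrable f volume (x / ε) (y / ε) := intervalIntegrable_iff.2
      ((hf.integrableOn_isCompact isCompact_uIcc).mono_set Set.uIoc_subset_uIcc)
    have h := h0.comp_mul_left (c := ε⁻¹)
    simpa [div_eq_inv_mul, mul_inv_cancel_left₀ hε] using h

variable {Ω : Type*} {b : ℝ → Ω → ℝ} {α ε : ℝ}

theorem rescaledIntegral_sub {ω : Ω} (h : LocallyIntegrable (fun u => b u ω) volume) (x y : ℝ) :
    rescaledIntegral α b ε y ω - rescaledIntegral α b ε x ω =
      ε ^ (-(α / 2)) * ∫ u in x..y, b (u / ε) ω := by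
  rw [rescaledIntegral, rescaledIntegral, ← mul_sub,
    intervalIntegral.integral_interval_sub_left (h.intervalIntegrable_comp_div ε 0 y)
      (h.intervalIntegrable_comp_div ε 0 x)]

theorem continuous_rescaledIntegral {ω : Ω} (h : LocallyIntegrable (fun u => b u ω) volume) :
    Continuous fun x => rescaledIntegral α b ε x ω :=
  (intervalIntegral.continuous_primitive
    (fun x y => h.intervalIntegrable_comp_div ε x y) 0).const_mul _

theorem rescaledPath_apply {ω : Ω} (h : LocallyIntegrable (fun u => b u ω) volume) (x : ℝ) :
    rescaledPath α b ε ω x = rescaledIntegral α b ε x ω := by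
  rw [rescaledPath, dif_pos (continuous_rescaledIntegral h)]
  rfl

variable [MeasurableSpace Ω] {P : Measure Ω}

/-- A jointly measurable process, bounded in `L²`. -/
structure IsBoundedL2Process (b : ℝ → Ω → ℝ) (P : Measure Ω) : Prop where
  measurable : Measurable (Function.uncurry b)
  memLp : ∀ u, MemLp (b u) 2 P
  exists_sq_le : ∃ B : ℝ, ∀ u, ∫ ω, b u ω ^ 2 ∂P ≤ B

theorem IsBoundedL2Process.comp_div (hb : IsBoundedL2Process b P) (ε : ℝ) :
    IsBoundedL2Process (fun u => b (u / ε)) P where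
  measurable := hb.measurable.comp (f := fun p : ℝ × Ω => (p.1 / ε, p.2)) (by fun_prop)
  memLp u := hb.memLp (u / ε)
  exists_sq_le := ⟨hb.exists_sq_le.choose, fun u => hb.exists_sq_le.choose_spec (u / ε)⟩

theorem integral_sq_increment_symm (x y : ℝ) :
    ∫ ω, (rescaledIntegral α b ε y ω - rescaledIntegral α b ε x ω) ^ 2 ∂P =
      ∫ ω, (rescaledIntegral α b ε x ω - rescaledIntegral α b ε y ω) ^ 2 ∂P := by
  congr 1; ext ω; ring

variable [IsProbabilityMeasure P]

theorem IsBoundedL2Process.ae_locallyIntegrable (hb : IsBoundedL2Process b P) :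
    ∀ᵐ ω ∂P, LocallyIntegrable (fun u => b u ω) volume := by
  obtain ⟨B, hB⟩ := hb.exists_sq_le
  have h : ∀ᵐ ω ∂P, ∀ n : ℕ, IntegrableOn (fun u => b u ω) (Set.Icc (-(n : ℝ)) n) volume :=
    ae_all_iff.2 fun n => ae_integrable_of_sq_le hb.measurable hb.memLp hB
  filter_upwards [h] with ω hω
  intro x
  obtain ⟨n, hn⟩ := exists_nat_gt |x|
  exact ⟨Set.Icc (-(n : ℝ)) n, Icc_mem_nhds (abs_lt.1 hn).1 (abs_lt.1 hn).2, hω n⟩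

theorem IsBoundedL2Process.memLp_intervalIntegral (hb : IsBoundedL2Process b P) (x y : ℝ) :
    MemLp (fun ω => ∫ u in x..y, b u ω) 2 P := by
  obtain ⟨B, hB⟩ := hb.exists_sq_le
  simp_rw [intervalIntegral.intervalIntegral_eq_integral_uIoc, smul_eq_mul]
  have : IsFiniteMeasure (volume.restrict (Set.uIoc x y)) :=
    inferInstanceAs (IsFiniteMeasure (volume.restrict (Set.Ioc (min x y) (max x y))))
  exact (memLp_two_integral_of_sq_le (μ := volume.restrict (Set.uIoc x y)) hb.measurable
    hb.memLp hB).const_mul _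

theorem IsBoundedL2Process.memLp_rescaledIntegral (hb : IsBoundedL2Process b P) (x : ℝ) :
    MemLp (rescaledIntegral α b ε x) 2 P :=
  ((hb.comp_div ε).memLp_intervalIntegral 0 x).const_mul _

/-- The second moment of an increment is the integral of the rescaled covariance. -/
theorem IsBoundedL2Process.integral_sq_increment (hb : IsBoundedL2Process b P) (hε : 0 < ε)
    {x y : ℝ} (hxy : x ≤ y) :
    ∫ ω, (rescaledIntegral α b ε y ω - rescaledIntegral α b ε x ω) ^ 2 ∂P =
      ∫ z : ℝ × ℝ, ε ^ (-α) * ∫ ω, b (z.1 / ε) ω * b (z.2 / ε) ω ∂P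
        ∂((volume.restrict (Set.Ioc x y)).prod (volume.restrict (Set.Ioc x y))) := by
  obtain ⟨B, hB⟩ := hb.exists_sq_le
  have h1 : ∫ ω, (rescaledIntegral α b ε y ω - rescaledIntegral α b ε x ω) ^ 2 ∂P =
      ∫ ω, ε ^ (-α) * (∫ u in Set.Ioc x y, b (u / ε) ω) ^ 2 ∂P := by
    refine integral_congr_ae ?_
    filter_upwards [hb.ae_locallyIntegrable] with ω hω
    rw [rescaledIntegral_sub hω, mul_pow, intervalIntegral.integral_of_le hxy,
      ← Real.rpow_natCast, ← Real.rpow_mul hε.le]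
    congr 2
    push_cast; ring
  rw [h1, integral_const_mul, integral_const_mul,
    integral_sq_integral_eq (hb.comp_div ε).measurable (hb.comp_div ε).memLp
      (fun u => hB (u / ε))]

/-- If the rescaled covariance is dominated by the Riesz kernel, then increments satisfy a
Kolmogorov bound. -/
theorem IsBoundedL2Process.integral_sq_increment_le (hb : IsBoundedL2Process b P) (hα : α < 1)
    (hε : 0 < ε) {C : ℝ}
    (hC : ∀ u v, u ≠ v → ε ^ (-α) * |∫ ω, b (u / ε) ω * b (v / ε) ω ∂P| ≤ C * |v - u| ^ (-α))
    (x y : ℝ) :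
    ∫ ω, (rescaledIntegral α b ε y ω - rescaledIntegral α b ε x ω) ^ 2 ∂P ≤
      C * (2 / ((1 - α) * (2 - α)) * |y - x| ^ (2 - α)) := by
  wlog hxy : x ≤ y generalizing x y
  · rw [integral_sq_increment_symm, abs_sub_comm]
    exact this y x (le_of_not_ge hxy)
  rw [hb.integral_sq_increment hε hxy, abs_of_nonneg (sub_nonneg.2 hxy),
    ← integral_abs_sub_rpow_neg_prod hα hxy, ← integral_const_mul]
  refine (le_abs_self _).trans ((abs_integral_le_integral_abs).trans ?_)
  refine integral_mono_of_nonneg (Eventually.of_forall fun _ => abs_nonneg _)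
    ((integrable_abs_sub_rpow_neg hα x y).const_mul C) ?_
  filter_upwards [ae_prod_restrict_ne (Set.Ioc x y) (Set.Ioc x y)] with z hz
  rw [abs_mul, abs_of_pos (by positivity)]
  exact hC _ _ (sub_ne_zero.1 hz).symm

end Rescaled

/-! ### Covariance of the long-range field -/

section Field

variable {Ω : Type*} [MeasurableSpace Ω] {P : Measure Ω} {g : ℝ → Ω → ℝ} {α κ : ℝ}

/-- The covariance function of a centered stationary field. -/
noncomputable def stationaryCov (g : ℝ → Ω → ℝ) (P : Measure Ω) (x : ℝ) : ℝ :=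
  ∫ ω, g 0 ω * g x ω ∂P

namespace IsLongRangeGaussianField

theorem integral_mul (hg : IsLongRangeGaussianField g P α κ) (u v : ℝ) :
    ∫ ω, g u ω * g v ω ∂P = stationaryCov g P (v - u) := by
  have h := ((hg.stationary u).comp (u := fun w : ℝ → ℝ => w 0 * w (v - u))
    (by fun_prop)).integral_eq
  simpa [Function.comp_def, stationaryCov] using h

theorem integral_sq (hg : IsLongRangeGaussianField g P α κ) (u : ℝ) :
    ∫ ω, g u ω ^ 2 ∂P = 1 := by
  simp_rw [sq]
  rw [hg.integral_mul, sub_self, ← hg.variance_one]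
  simp [stationaryCov, sq]

theorem memLp_two (hg : IsLongRangeGaussianField g P α κ) (u : ℝ) : MemLp (g u) 2 P :=
  (hg.gaussian.hasGaussianLaw_eval u).memLp_two

theorem map_eq (hg : IsLongRangeGaussianField g P α κ) (u : ℝ) :
    P.map (g u) = gaussianReal 0 1 := by
  have h := hg.gaussian.hasGaussianLaw_eval u
  rw [h.map_eq_gaussianReal, variance_of_integral_eq_zero h.aemeasurable (hg.centered u),
    hg.integral_sq, hg.centered]
  simp

theorem measurable_stationaryCov [SFinite P] (hg : IsLongRangeGaussianField g P α κ) :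
    Measurable (stationaryCov g P) := by
  have h : StronglyMeasurable (fun p : ℝ × Ω => g 0 p.2 * g p.1 p.2) :=
    ((hg.measurable.comp (f := fun p : ℝ × Ω => ((0 : ℝ), p.2)) (by fun_prop)).mul
      hg.measurable).stronglyMeasurable
  exact (h.integral_prod_right' (ν := P)).measurable

theorem isBoundedL2Process (hg : IsLongRangeGaussianField g P α κ) : IsBoundedL2Process g P where
  measurable := hg.measurable
  memLp := hg.memLp_two
  exists_sq_le := ⟨1, fun u => (hg.integral_sq u).le⟩

theorem isBoundedL2Process_comp (hg : IsLongRangeGaussianField g P α κ) {Ψ : ℝ → ℝ}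
    (hΨ : Measurable Ψ) (hL : MemLp Ψ 2 (gaussianReal 0 1)) :
    IsBoundedL2Process (fun u ω => Ψ (g u ω)) P where
  measurable := hΨ.comp hg.measurable
  memLp u := by
    rw [← hg.map_eq u] at hL
    exact hL.comp_of_map (hg.gaussian.aemeasurable u)
  exists_sq_le := ⟨∫ z, Ψ z ^ 2 ∂(gaussianReal 0 1), fun u => by
    rw [← hg.map_eq u, integral_map (hg.gaussian.aemeasurable u) (by fun_prop)]⟩

theorem abs_stationaryCov_le_one [IsProbabilityMeasure P] (hg : IsLongRangeGaussianField g P α κ)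
    (x : ℝ) : |stationaryCov g P x| ≤ 1 := by
  have h1 : ∫ ω, (g 0 ω - g x ω) ^ 2 ∂P = 2 - 2 * stationaryCov g P x := by
    have : ∀ ω, (g 0 ω - g x ω) ^ 2 = g 0 ω ^ 2 + g x ω ^ 2 - 2 * (g 0 ω * g x ω) := fun ω => by
      ring
    have hi : Integrable (fun ω => g 0 ω * g x ω) P := (hg.memLp_two 0).integrable_mul (hg.memLp_two x)
    have hs : Integrable (fun ω => g 0 ω ^ 2 + g x ω ^ 2) P :=
      (hg.memLp_two 0).integrable_sq.add (hg.memLp_two x).integrable_sq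
    simp_rw [this]
    rw [integral_sub hs (hi.const_mul 2),
      integral_add (hg.memLp_two 0).integrable_sq (hg.memLp_two x).integrable_sq,
      integral_const_mul, hg.integral_sq, hg.integral_sq, stationaryCov]
    ring
  have h2 : ∫ ω, (g 0 ω + g x ω) ^ 2 ∂P = 2 + 2 * stationaryCov g P x := by
    have : ∀ ω, (g 0 ω + g x ω) ^ 2 = g 0 ω ^ 2 + g x ω ^ 2 + 2 * (g 0 ω * g x ω) := fun ω => by
      ring
    have hi : Integrable (fun ω => g 0 ω * g x ω) P := (hg.memLp_two 0).integrable_mul (hg.memLp_two x)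
    have hs : Integrable (fun ω => g 0 ω ^ 2 + g x ω ^ 2) P :=
      (hg.memLp_two 0).integrable_sq.add (hg.memLp_two x).integrable_sq
    simp_rw [this]
    rw [integral_add hs (hi.const_mul 2),
      integral_add (hg.memLp_two 0).integrable_sq (hg.memLp_two x).integrable_sq,
      integral_const_mul, hg.integral_sq, hg.integral_sq, stationaryCov]
    ring
  have p1 : 0 ≤ ∫ ω, (g 0 ω - g x ω) ^ 2 ∂P := integral_nonneg fun _ => sq_nonneg _
  have p2 : 0 ≤ ∫ ω, (g 0 ω + g x ω) ^ 2 ∂P := integral_nonneg fun _ => sq_nonneg _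
  rw [abs_le]; constructor <;> linarith

/-- Global domination of the covariance by the Riesz kernel. -/
theorem exists_abs_stationaryCov_le [IsProbabilityMeasure P]
    (hg : IsLongRangeGaussianField g P α κ) (hα : 0 < α) :
    ∃ C : ℝ, 0 ≤ C ∧ ∀ x, x ≠ 0 → |stationaryCov g P x| ≤ C * |x| ^ (-α) := by
  obtain ⟨c, hc0, hc⟩ := hg.covariance_asymp.isBigO.exists_pos
  have h := hc.bound
  obtain ⟨r, -, hr⟩ := (hasBasis_cobounded_norm (E := ℝ)).mem_iff.1 h
  have hs1 : (0 : ℝ) < max r 1 := lt_max_of_lt_right one_pos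
  -- The first term handles `|x| ≥ r` by the asymptotics. For smaller `|x|`, the second makes the
  -- bound at least `1`, which dominates any correlation.
  refine ⟨c * |κ| + max r 1 ^ α, by positivity, fun x hx => ?_⟩
  have hx0 : 0 < |x| := abs_pos.2 hx
  have hxα : 0 < |x| ^ (-α) := by positivity
  rw [add_mul]
  by_cases hxr : r ≤ |x|
  · have h3 : |stationaryCov g P x| ≤ c * ‖κ * |x| ^ (-α)‖ := hr hxr
    rw [norm_mul, Real.norm_eq_abs, Real.norm_of_nonneg hxα.le, ← mul_assoc] at h3
    have : 0 ≤ max r 1 ^ α * |x| ^ (-α) := by positivity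
    linarith
  · have h4 : 1 ≤ max r 1 ^ α * |x| ^ (-α) := by
      rw [Real.rpow_neg hx0.le, ← div_eq_mul_inv, one_le_div (by positivity)]
      exact Real.rpow_le_rpow hx0.le ((not_le.1 hxr).le.trans (le_max_left _ _)) hα.le
    have : 0 ≤ c * |κ| * |x| ^ (-α) := by positivity
    linarith [hg.abs_stationaryCov_le_one x]

theorem tendsto_rescaled_stationaryCov (hg : IsLongRangeGaussianField g P α κ) (hκ : 0 < κ)
    {w : ℝ} (hw : w ≠ 0) :
    Tendsto (fun ε : ℝ => ε ^ (-α) * stationaryCov g P (w / ε)) (𝓝[>] 0)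
      (𝓝 (κ * |w| ^ (-α))) := by
  have hlim : Tendsto (fun ε : ℝ => w / ε) (𝓝[>] 0) (Bornology.cobounded ℝ) := by
    rw [← tendsto_norm_atTop_iff_cobounded]
    have h : Tendsto (fun ε : ℝ => |w| * ε⁻¹) (𝓝[>] 0) atTop :=
      tendsto_inv_nhdsGT_zero.const_mul_atTop (abs_pos.2 hw)
    refine h.congr' ?_
    filter_upwards [self_mem_nhdsWithin] with ε (hε : 0 < ε)
    rw [norm_div, Real.norm_eq_abs, Real.norm_of_nonneg hε.le, div_eq_mul_inv]
  -- Nonvanishing, from `κ > 0`, permits reading the asymptotic equivalence as a ratio tending to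
  -- `1`.
  have hne : ∀ᶠ x : ℝ in Bornology.cobounded ℝ, κ * |x| ^ (-α) ≠ 0 := by
    filter_upwards [(hasBasis_cobounded_norm (E := ℝ)).mem_of_mem (i := 1) trivial] with x hx
    have : 0 < |x| := one_pos.trans_le hx
    positivity
  have h1 := (((isEquivalent_iff_tendsto_one hne).1 hg.covariance_asymp).comp hlim).mul_const
    (κ * |w| ^ (-α))
  rw [one_mul] at h1
  refine h1.congr' ?_
  filter_upwards [self_mem_nhdsWithin] with ε (hε : 0 < ε)
  have hw0 := abs_pos.2 hw
  simp only [Function.comp_apply, Pi.div_apply]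
  rw [abs_div, abs_of_pos hε, Real.div_rpow hw0.le hε.le, stationaryCov]
  have h2 : |w| ^ (-α) ≠ 0 := by positivity
  have h3 : ε ^ (-α) ≠ 0 := by positivity
  field_simp

end IsLongRangeGaussianField

end Field

/-! ### Splitting off the linear Hermite component -/

section Transform

theorem hermiteCoeff_zero (Φ : ℝ → ℝ) : hermiteCoeff Φ 0 = ∫ z, Φ z ∂(gaussianReal 0 1) := by
  simp [hermiteCoeff]

theorem hermiteCoeff_one (Φ : ℝ → ℝ) : hermiteCoeff Φ 1 = ∫ z, Φ z * z ∂(gaussianReal 0 1) := by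
  simp [hermiteCoeff]

namespace IsRankOneTransform

variable {Φ : ℝ → ℝ}

theorem integral_eq_zero (hΦ : IsRankOneTransform Φ) : ∫ z, Φ z ∂(gaussianReal 0 1) = 0 := by
  by_contra h
  have := hΦ.rank_one.2 (show (0 : ℕ) ∈ {q : ℕ | hermiteCoeff Φ q ≠ 0} by
    rwa [Set.mem_ofPred_eq, hermiteCoeff_zero])
  omega

theorem hermiteCoeff_one_ne_zero (hΦ : IsRankOneTransform Φ) : hermiteCoeff Φ 1 ≠ 0 :=
  hΦ.rank_one.1

theorem differentiable (hΦ : IsRankOneTransform Φ) : Differentiable ℝ Φ :=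
  hΦ.contDiff.differentiable (by norm_num)

theorem exists_deriv_lipschitz (hΦ : IsRankOneTransform Φ) :
    ∃ M : ℝ, ∀ x y, |deriv Φ x - deriv Φ y| ≤ M * |x - y| := by
  obtain ⟨M, hM⟩ := hΦ.bounded_second_deriv
  refine ⟨M, fun x y => ?_⟩
  have hd : Differentiable ℝ (deriv Φ) :=
    ((contDiff_succ_iff_deriv (n := 1)).1 hΦ.contDiff).2.2.differentiable (by norm_num)
  have hM' : ∀ z ∈ Set.univ, ‖deriv (deriv Φ) z‖ ≤ M := fun z _ => by
    have := hM z
    rwa [iteratedDeriv_succ, iteratedDeriv_one] at this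
  exact Convex.norm_image_sub_le_of_norm_deriv_le (fun z _ => hd z) hM' convex_univ
    (Set.mem_univ y) (Set.mem_univ x)

end IsRankOneTransform

/-- The part of `Φ` of Hermite rank at least two. -/
noncomputable def rankTwoPart (Φ : ℝ → ℝ) (z : ℝ) : ℝ := Φ z - hermiteCoeff Φ 1 * z

theorem memLp_id_gaussianReal_two : MemLp (fun z : ℝ => z) 2 (gaussianReal 0 1) :=
  memLp_id_gaussianReal 2

theorem integral_sq_gaussianReal : ∫ z : ℝ, z ^ 2 ∂(gaussianReal 0 1) = 1 := by
  have h := variance_of_integral_eq_zero (μ := gaussianReal 0 1) (X := fun z : ℝ => z)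
    aemeasurable_id integral_id_gaussianReal
  rw [← h]
  simp

variable {Φ : ℝ → ℝ}

theorem memLp_rankTwoPart (hΦ : IsRankOneTransform Φ) :
    MemLp (rankTwoPart Φ) 2 (gaussianReal 0 1) :=
  hΦ.memLp.sub (memLp_id_gaussianReal_two.const_mul _)

theorem integral_rankTwoPart (hΦ : IsRankOneTransform Φ) :
    ∫ z, rankTwoPart Φ z ∂(gaussianReal 0 1) = 0 := by
  simp only [rankTwoPart]
  rw [integral_sub (hΦ.memLp.integrable (by norm_num))
    ((memLp_id_gaussianReal_two.integrable (by norm_num)).const_mul _), hΦ.integral_eq_zero,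
    integral_const_mul, integral_id_gaussianReal]
  simp

theorem integral_rankTwoPart_mul (hΦ : IsRankOneTransform Φ) :
    ∫ z, rankTwoPart Φ z * z ∂(gaussianReal 0 1) = 0 := by
  have h : ∀ z, rankTwoPart Φ z * z = Φ z * z - hermiteCoeff Φ 1 * z ^ 2 := fun z => by
    rw [rankTwoPart]; ring
  have hi : Integrable (fun z => Φ z * z) (gaussianReal 0 1) :=
    hΦ.memLp.integrable_mul memLp_id_gaussianReal_two
  simp_rw [h]
  rw [integral_sub hi (memLp_id_gaussianReal_two.integrable_sq.const_mul _), integral_const_mul,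
    integral_sq_gaussianReal, hermiteCoeff_one]
  ring

theorem differentiable_rankTwoPart (hΦ : IsRankOneTransform Φ) :
    Differentiable ℝ (rankTwoPart Φ) :=
  hΦ.differentiable.sub (differentiable_id.const_mul _)

theorem deriv_rankTwoPart (hΦ : IsRankOneTransform Φ) (z : ℝ) :
    deriv (rankTwoPart Φ) z = deriv Φ z - hermiteCoeff Φ 1 := by
  have h := (hasDerivAt_id z).const_mul (hermiteCoeff Φ 1)
  rw [mul_one] at h
  exact ((hΦ.differentiable z).hasDerivAt.sub h).deriv

variable {Ω : Type*} [MeasurableSpace Ω] {P : Measure Ω} {g : ℝ → Ω → ℝ} {α κ : ℝ}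

theorem IsLongRangeGaussianField.exists_abs_integral_rankTwoPart_le
    (hg : IsLongRangeGaussianField g P α κ) (hΦ : IsRankOneTransform Φ) :
    ∃ D : ℝ, 0 ≤ D ∧ ∀ u v, |∫ ω, rankTwoPart Φ (g u ω) * rankTwoPart Φ (g v ω) ∂P| ≤
      D * stationaryCov g P (v - u) ^ 2 := by
  obtain ⟨M, hM⟩ := hΦ.exists_deriv_lipschitz
  have hM0 : 0 ≤ M := by simpa using (abs_nonneg _).trans (hM 1 0)
  refine ⟨M * ∫ z, |rankTwoPart Φ z| * z ^ 2 ∂(gaussianReal 0 1),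
    mul_nonneg hM0 (integral_nonneg fun z => by positivity), fun u v => ?_⟩
  rw [← hg.integral_mul]
  refine abs_integral_mul_le_of_rank_two hg.gaussian.hasGaussianLaw_prodMk (hg.centered u)
    (hg.integral_sq u) (hg.map_eq u) (hg.map_eq v) (differentiable_rankTwoPart hΦ)
    (fun x y => ?_) (memLp_rankTwoPart hΦ) (integral_rankTwoPart hΦ) (integral_rankTwoPart_mul hΦ)
  -- Removing a linear term shifts the derivative by a constant, so the Lipschitz constant is
  -- unchanged.
  rw [deriv_rankTwoPart hΦ, deriv_rankTwoPart hΦ]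
  simpa using hM x y

theorem IsLongRangeGaussianField.isBoundedL2Process_rankTwoPart
    (hg : IsLongRangeGaussianField g P α κ) (hΦ : IsRankOneTransform Φ) :
    IsBoundedL2Process (fun u ω => rankTwoPart Φ (g u ω)) P :=
  hg.isBoundedL2Process_comp (differentiable_rankTwoPart hΦ).continuous.measurable
    (memLp_rankTwoPart hΦ)

variable [IsProbabilityMeasure P]

/-- The Riesz kernel is homogeneous of degree `-α`, so the powers of `ε` cancel and one constant
serves all scales. -/
theorem IsLongRangeGaussianField.exists_rescaled_cov_le (hg : IsLongRangeGaussianField g P α κ)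
    (hα : 0 < α) :
    ∃ C : ℝ, 0 ≤ C ∧ ∀ ε : ℝ, 0 < ε → ∀ w : ℝ, w ≠ 0 →
      |ε ^ (-α) * stationaryCov g P (w / ε)| ≤ C * |w| ^ (-α) := by
  obtain ⟨C, hC0, hC⟩ := hg.exists_abs_stationaryCov_le hα
  refine ⟨C, hC0, fun ε hε w hw => ?_⟩
  have hw0 := abs_pos.2 hw
  rw [abs_mul, abs_of_pos (by positivity)]
  calc ε ^ (-α) * |stationaryCov g P (w / ε)| ≤ ε ^ (-α) * (C * |w / ε| ^ (-α)) := by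
        gcongr
        exact hC _ (div_ne_zero hw hε.ne')
    _ = C * |w| ^ (-α) := by
        rw [abs_div, abs_of_pos hε, Real.div_rpow hw0.le hε.le]
        have h3 : ε ^ (-α) ≠ 0 := by positivity
        field_simp

theorem IsLongRangeGaussianField.tendsto_integral_sq_increment
    (hg : IsLongRangeGaussianField g P α κ) (hα : α ∈ Set.Ioo (0 : ℝ) 1) (hκ : 0 < κ) (x y : ℝ) :
    Tendsto (fun ε => ∫ ω, (rescaledIntegral α g ε y ω - rescaledIntegral α g ε x ω) ^ 2 ∂P)
      (𝓝[>] 0) (𝓝 (κ * (2 / ((1 - α) * (2 - α)) * |y - x| ^ (2 - α)))) := by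
  wlog hxy : x ≤ y generalizing x y
  · simp_rw [integral_sq_increment_symm (P := P) x y, abs_sub_comm y x]
    exact this y x (le_of_not_ge hxy)
  rw [abs_of_nonneg (sub_nonneg.2 hxy)]
  obtain ⟨C, hC0, hC⟩ := hg.exists_rescaled_cov_le hα.1
  have h := tendsto_integral_kernel (l := 𝓝[>] (0 : ℝ)) hα.2 hxy
    (r := fun ε w => ε ^ (-α) * stationaryCov g P (w / ε)) (C := C) (c := κ)
    (fun ε => (hg.measurable_stationaryCov.comp (by fun_prop)).const_mul _)
    (by filter_upwards [self_mem_nhdsWithin] with ε hε using hC ε hε)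
    (fun w hw => hg.tendsto_rescaled_stationaryCov hκ hw)
  refine h.congr' ?_
  filter_upwards [self_mem_nhdsWithin] with ε hε
  rw [hg.isBoundedL2Process.integral_sq_increment hε hxy]
  simp_rw [hg.integral_mul, sub_div]

/-- Writing `ε^(-α) R²` as `(ε^(-α) R) · R`, the first factor is dominated by the Riesz kernel and
the second is bounded by `1` and tends to `0`. The square of the Riesz kernel, which need not be
integrable, never appears. -/
theorem IsLongRangeGaussianField.tendsto_integral_sq_increment_rankTwoPart
    (hg : IsLongRangeGaussianField g P α κ) (hα : α ∈ Set.Ioo (0 : ℝ) 1) (hκ : 0 < κ)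
    (hΦ : IsRankOneTransform Φ) (x y : ℝ) :
    Tendsto (fun ε => ∫ ω, (rescaledIntegral α (fun u ω => rankTwoPart Φ (g u ω)) ε y ω -
      rescaledIntegral α (fun u ω => rankTwoPart Φ (g u ω)) ε x ω) ^ 2 ∂P) (𝓝[>] 0) (𝓝 0) := by
  wlog hxy : x ≤ y generalizing x y
  · simp_rw [integral_sq_increment_symm (P := P) x y]
    exact this y x (le_of_not_ge hxy)
  obtain ⟨C, hC0, hC⟩ := hg.exists_rescaled_cov_le hα.1
  obtain ⟨D, hD0, hD⟩ := hg.exists_abs_integral_rankTwoPart_le hΦ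
  have hm := hg.measurable_stationaryCov
  -- `R(w/ε)` is `ε^α` times a convergent quantity.
  have hR0 : ∀ w : ℝ, w ≠ 0 → Tendsto (fun ε : ℝ => stationaryCov g P (w / ε)) (𝓝[>] 0) (𝓝 0) := by
    intro w hw
    have h1 := hg.tendsto_rescaled_stationaryCov hκ hw
    have h2 : Tendsto (fun ε : ℝ => ε ^ α) (𝓝[>] 0) (𝓝 0) := by
      have := (Real.continuousAt_rpow_const 0 α (Or.inr hα.1.le)).tendsto
      rw [Real.zero_rpow hα.1.ne'] at this
      exact this.mono_left nhdsWithin_le_nhds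
    have h3 := h2.mul h1
    rw [zero_mul] at h3
    refine h3.congr' ?_
    filter_upwards [self_mem_nhdsWithin] with ε (hε : 0 < ε)
    rw [← mul_assoc, ← Real.rpow_add hε, add_neg_cancel, Real.rpow_zero, one_mul]
  have hK : ∀ ε : ℝ, 0 < ε → ∀ w : ℝ, w ≠ 0 →
      |D * (ε ^ (-α) * stationaryCov g P (w / ε)) * stationaryCov g P (w / ε)| ≤
        D * C * |w| ^ (-α) := by
    intro ε hε w hw
    rw [abs_mul, abs_mul, abs_of_nonneg hD0, mul_assoc D C]
    have h1 := hC ε hε w hw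
    have h2 := hg.abs_stationaryCov_le_one (w / ε)
    calc D * |ε ^ (-α) * stationaryCov g P (w / ε)| * |stationaryCov g P (w / ε)|
        ≤ D * |ε ^ (-α) * stationaryCov g P (w / ε)| * 1 := by gcongr
      _ ≤ D * (C * |w| ^ (-α)) := by rw [mul_one]; gcongr
  have h := tendsto_integral_kernel (l := 𝓝[>] (0 : ℝ)) hα.2 hxy
    (r := fun ε w => D * (ε ^ (-α) * stationaryCov g P (w / ε)) * stationaryCov g P (w / ε))
    (C := D * C) (c := 0)
    (fun ε => (((hm.comp (by fun_prop)).const_mul _).const_mul _).mul (hm.comp (by fun_prop)))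
    (by filter_upwards [self_mem_nhdsWithin] with ε hε using hK ε hε)
    (fun w hw => by
      have := ((hg.tendsto_rescaled_stationaryCov hκ hw).const_mul D).mul (hR0 w hw)
      simpa using this)
  rw [zero_mul] at h
  refine tendsto_of_tendsto_of_tendsto_of_le_of_le' tendsto_const_nhds h
    (Eventually.of_forall fun ε => integral_nonneg fun _ => sq_nonneg _) ?_
  filter_upwards [self_mem_nhdsWithin] with ε (hε : 0 < ε)
  rw [(hg.isBoundedL2Process_rankTwoPart hΦ).integral_sq_increment hε hxy]
  refine (le_abs_self _).trans (abs_integral_le_integral_abs.trans ?_)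
  refine integral_mono_of_nonneg (Eventually.of_forall fun _ => abs_nonneg _) ?_
    (Eventually.of_forall fun z => ?_)
  · refine Integrable.mono' ((integrable_abs_sub_rpow_neg hα.2 x y).const_mul (D * C)) ?_ ?_
    · exact ((((hm.comp (by fun_prop)).const_mul _).const_mul _).mul
        (hm.comp (by fun_prop))).aestronglyMeasurable
    · filter_upwards [ae_prod_restrict_ne (Set.Ioc x y) (Set.Ioc x y)] with z hz
      exact hK ε hε _ hz
  · simp only
    rw [abs_mul, abs_of_pos (by positivity)]
    have := hD (z.1 / ε) (z.2 / ε)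
    rw [← sub_div] at this
    calc ε ^ (-α) * _ ≤ ε ^ (-α) * (D * stationaryCov g P ((z.2 - z.1) / ε) ^ 2) := by gcongr
      _ = _ := by ring

end Transform

/-! ### Finite-dimensional convergence and uniform increment bounds -/

/-- The covariance kernel of fractional Brownian motion. -/
noncomputable def fbmKernel (H x y : ℝ) : ℝ :=
  (1 / 2) * (|x| ^ (2 * H) + |y| ^ (2 * H) - |x - y| ^ (2 * H))

section FiniteDimensional

variable {Ω : Type*} {g b : ℝ → Ω → ℝ} {α κ ε : ℝ} {Φ : ℝ → ℝ}

theorem rescaledIntegral_zero (α ε : ℝ) (b : ℝ → Ω → ℝ) (ω : Ω) :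
    rescaledIntegral α b ε 0 ω = 0 := by
  simp [rescaledIntegral]

theorem rescaledIntegral_eq_add {ω : Ω}
    (h1 : LocallyIntegrable (fun u => g u ω) volume)
    (h2 : LocallyIntegrable (fun u => rankTwoPart Φ (g u ω)) volume) (x : ℝ) :
    rescaledIntegral α (fun u ω => Φ (g u ω)) ε x ω =
      hermiteCoeff Φ 1 * rescaledIntegral α g ε x ω +
        rescaledIntegral α (fun u ω => rankTwoPart Φ (g u ω)) ε x ω := by
  have h : ∀ u, Φ (g u ω) = hermiteCoeff Φ 1 * g u ω + rankTwoPart Φ (g u ω) := fun u => by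
    rw [rankTwoPart]; ring
  simp only [rescaledIntegral, h]
  rw [intervalIntegral.integral_add ((h1.intervalIntegrable_comp_div ε 0 x).const_mul _)
    (h2.intervalIntegrable_comp_div ε 0 x), intervalIntegral.integral_const_mul]
  ring

variable [MeasurableSpace Ω] {P : Measure Ω}

theorem integral_sq_sum {X : ℝ → Ω → ℝ} (hX : ∀ x, MemLp (X x) 2 P) (I : Finset ℝ) (c : ℝ → ℝ) :
    ∫ ω, (∑ x ∈ I, c x * X x ω) ^ 2 ∂P =
      ∑ x ∈ I, ∑ y ∈ I, c x * c y * ∫ ω, X x ω * X y ω ∂P := by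
  have h : ∀ ω, (∑ x ∈ I, c x * X x ω) ^ 2 =
      ∑ x ∈ I, ∑ y ∈ I, c x * c y * (X x ω * X y ω) := fun ω => by
    rw [sq, Finset.sum_mul_sum]
    refine Finset.sum_congr rfl fun x _ => Finset.sum_congr rfl fun y _ => by ring
  have hi : ∀ x y, Integrable (fun ω => c x * c y * (X x ω * X y ω)) P := fun x y =>
    ((hX x).integrable_mul (hX y)).const_mul _
  simp_rw [h]
  rw [integral_finsetSum _ fun x _ => integrable_finsetSum _ fun y _ => hi x y]
  refine Finset.sum_congr rfl fun x _ => ?_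
  rw [integral_finsetSum _ fun y _ => hi x y]
  exact Finset.sum_congr rfl fun y _ => integral_const_mul _ _

theorem integral_mul_eq_half_increments {X Y : Ω → ℝ} (hX : MemLp X 2 P) (hY : MemLp Y 2 P) :
    ∫ ω, X ω * Y ω ∂P = (1 / 2) * (∫ ω, X ω ^ 2 ∂P + ∫ ω, Y ω ^ 2 ∂P -
      ∫ ω, (X ω - Y ω) ^ 2 ∂P) := by
  have h : ∀ ω, (X ω - Y ω) ^ 2 = X ω ^ 2 + Y ω ^ 2 - 2 * (X ω * Y ω) := fun ω => by ring
  have hi : Integrable (fun ω => X ω * Y ω) P := hX.integrable_mul hY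
  have hs : Integrable (fun ω => X ω ^ 2 + Y ω ^ 2) P := hX.integrable_sq.add hY.integrable_sq
  simp_rw [h]
  rw [integral_sub hs (hi.const_mul 2), integral_add hX.integrable_sq hY.integrable_sq,
    integral_const_mul]
  ring

/-- Convergence of the second moments of increments gives convergence of the second moments
of finite linear combinations. -/
theorem tendsto_integral_sq_sum_of_increments {ι : Type*} {l : Filter ι} {X : ι → ℝ → Ω → ℝ}
    (hX : ∀ i x, MemLp (X i x) 2 P) (hX0 : ∀ i ω, X i 0 ω = 0) {s H : ℝ}
    (h : ∀ x y, Tendsto (fun i => ∫ ω, (X i y ω - X i x ω) ^ 2 ∂P) l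
      (𝓝 (s * |y - x| ^ (2 * H)))) (I : Finset ℝ) (c : ℝ → ℝ) :
    Tendsto (fun i => ∫ ω, (∑ x ∈ I, c x * X i x ω) ^ 2 ∂P) l
      (𝓝 (s * ∑ x ∈ I, ∑ y ∈ I, c x * c y * fbmKernel H x y)) := by
  simp_rw [integral_sq_sum (hX _), Finset.mul_sum]
  refine tendsto_finsetSum _ fun x _ => tendsto_finsetSum _ fun y _ => ?_
  -- Since the process vanishes at `0`, its second moment at `x` is that of the increment from `0`.
  have hsq : ∀ x, Tendsto (fun i => ∫ ω, X i x ω ^ 2 ∂P) l (𝓝 (s * |x| ^ (2 * H))) := by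
    intro x
    simpa [hX0] using h 0 x
  simp_rw [integral_mul_eq_half_increments (hX _ _) (hX _ _)]
  have := ((((hsq x).add (hsq y)).sub (h y x)).const_mul (1 / 2)).const_mul (c x * c y)
  convert this using 2
  rw [fbmKernel]; ring

theorem IsLongRangeGaussianField.isBoundedL2Process_transform
    (hg : IsLongRangeGaussianField g P α κ) (hΦ : IsRankOneTransform Φ) :
    IsBoundedL2Process (fun u ω => Φ (g u ω)) P :=
  hg.isBoundedL2Process_comp hΦ.differentiable.continuous.measurable hΦ.memLp

variable [IsProbabilityMeasure P]

/-- Supplies the orthogonality hypothesis of `integral_exp_mul_I_of_mem_gaussian_space`, making the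
linear part exactly Gaussian at every scale. -/
theorem IsBoundedL2Process.integral_mul_rescaledIntegral_eq_zero (hb : IsBoundedL2Process b P)
    {Y : Ω → ℝ} (hY : MemLp Y 2 P) (h : ∀ u, ∫ ω, Y ω * b u ω ∂P = 0) (x : ℝ) :
    ∫ ω, Y ω * rescaledIntegral α b ε x ω ∂P = 0 := by
  obtain ⟨B, hB⟩ := (hb.comp_div ε).exists_sq_le
  have : IsFiniteMeasure (volume.restrict (Set.uIoc 0 x)) :=
    inferInstanceAs (IsFiniteMeasure (volume.restrict (Set.Ioc (min 0 x) (max 0 x))))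
  have h1 := integral_mul_integral_eq (μ := volume.restrict (Set.uIoc 0 x))
    (hb.comp_div ε).measurable (hb.comp_div ε).memLp hB hY
  simp only [h, integral_zero] at h1
  have h2 : ∀ ω, Y ω * rescaledIntegral α b ε x ω = (ε ^ (-(α / 2)) * if 0 ≤ x then 1 else -1) *
      (Y ω * ∫ u in Set.uIoc 0 x, b (u / ε) ω) := fun ω => by
    rw [rescaledIntegral, intervalIntegral.intervalIntegral_eq_integral_uIoc, smul_eq_mul]
    ring
  simp_rw [h2]
  rw [integral_const_mul, h1, mul_zero]

theorem IsLongRangeGaussianField.ae_rescaledIntegral_eq_add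
    (hg : IsLongRangeGaussianField g P α κ) (hΦ : IsRankOneTransform Φ) :
    ∀ᵐ ω ∂P, ∀ ε x, rescaledIntegral α (fun u ω => Φ (g u ω)) ε x ω =
      hermiteCoeff Φ 1 * rescaledIntegral α g ε x ω +
        rescaledIntegral α (fun u ω => rankTwoPart Φ (g u ω)) ε x ω := by
  filter_upwards [hg.isBoundedL2Process.ae_locallyIntegrable,
    (hg.isBoundedL2Process_rankTwoPart hΦ).ae_locallyIntegrable] with ω h1 h2 ε x
  exact rescaledIntegral_eq_add h1 h2 x

/-- Convergence of the characteristic functions of the finite-dimensional distributions. -/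
theorem IsLongRangeGaussianField.tendsto_charFun
    (hg : IsLongRangeGaussianField g P α κ) (hα : α ∈ Set.Ioo (0 : ℝ) 1) (hκ : 0 < κ)
    (hΦ : IsRankOneTransform Φ) {H : ℝ} (hH : H = 1 - α / 2) (I : Finset ℝ) (c : ℝ → ℝ) :
    Tendsto (fun ε => ∫ ω, Complex.exp (((∑ x ∈ I, c x *
        rescaledIntegral α (fun u ω => Φ (g u ω)) ε x ω : ℝ) : ℂ) * Complex.I) ∂P) (𝓝[>] 0)
      (𝓝 (Complex.exp (-((hermiteCoeff Φ 1 ^ 2 * κ / (H * (2 * H - 1)) *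
        ∑ x ∈ I, ∑ y ∈ I, c x * c y * fbmKernel H x y : ℝ) : ℂ) / 2))) := by
  set V := hermiteCoeff Φ 1
  have hH2 : 2 * H = 2 - α := by rw [hH]; ring
  have hα1 := hα.2
  have hbg := hg.isBoundedL2Process
  have hbr := hg.isBoundedL2Process_rankTwoPart hΦ
  have hba := hg.isBoundedL2Process_transform hΦ
  have hvar : Tendsto (fun ε => ∫ ω, (∑ x ∈ I, (V * c x) * rescaledIntegral α g ε x ω) ^ 2 ∂P)
      (𝓝[>] 0) (𝓝 (V ^ 2 * κ / (H * (2 * H - 1)) *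
        ∑ x ∈ I, ∑ y ∈ I, c x * c y * fbmKernel H x y)) := by
    have h := tendsto_integral_sq_sum_of_increments (l := 𝓝[>] (0 : ℝ))
      (X := fun ε x => rescaledIntegral α g ε x) (P := P)
      (fun ε x => hbg.memLp_rescaledIntegral x) (fun ε => rescaledIntegral_zero α ε g)
      (s := κ * (2 / ((1 - α) * (2 - α)))) (fun x y => by
        rw [hH2, mul_assoc]; exact hg.tendsto_integral_sq_increment hα hκ x y) I
      (fun x => V * c x)
    convert h using 2
    have e1 : ∀ x y, V * c x * (V * c y) * fbmKernel H x y =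
        V ^ 2 * (c x * c y * fbmKernel H x y) := fun x y => by ring
    simp_rw [e1, ← Finset.mul_sum]
    have e2 : H * (2 * H - 1) = (1 - α) * (2 - α) / 2 := by rw [hH]; ring
    have e3 : (1 - α) ≠ 0 := by linarith
    have e4 : (2 - α) ≠ 0 := by linarith
    rw [e2]
    field_simp
  have hrem : Tendsto (fun ε => ∫ ω, (∑ x ∈ I, c x *
      rescaledIntegral α (fun u ω => rankTwoPart Φ (g u ω)) ε x ω) ^ 2 ∂P) (𝓝[>] 0) (𝓝 0) := by
    have h := tendsto_integral_sq_sum_of_increments (l := 𝓝[>] (0 : ℝ))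
      (X := fun ε x => rescaledIntegral α (fun u ω => rankTwoPart Φ (g u ω)) ε x) (P := P)
      (fun ε x => hbr.memLp_rescaledIntegral x) (fun ε => rescaledIntegral_zero α ε _)
      (s := 0) (H := H) (fun x y => by
        rw [zero_mul]
        exact hg.tendsto_integral_sq_increment_rankTwoPart hα hκ hΦ x y) I c
    rwa [zero_mul] at h
  have hlin : ∀ ε, MemLp (fun ω => ∑ x ∈ I, (V * c x) * rescaledIntegral α g ε x ω) 2 P :=
    fun ε => memLp_finsetSum _ fun x _ => (hbg.memLp_rescaledIntegral x).const_mul _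
  have hnon : ∀ ε, MemLp (fun ω => ∑ x ∈ I, c x *
      rescaledIntegral α (fun u ω => Φ (g u ω)) ε x ω) 2 P :=
    fun ε => memLp_finsetSum _ fun x _ => (hba.memLp_rescaledIntegral x).const_mul _
  have hchar : ∀ ε, ∫ ω, Complex.exp (((∑ x ∈ I, (V * c x) *
      rescaledIntegral α g ε x ω : ℝ) : ℂ) * Complex.I) ∂P =
      Complex.exp (-((∫ ω, (∑ x ∈ I, (V * c x) * rescaledIntegral α g ε x ω) ^ 2 ∂P : ℝ) : ℂ)
        / 2) := by
    intro ε
    refine integral_exp_mul_I_of_mem_gaussian_space hg.gaussian hg.centered (hlin ε)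
      fun Y hY hYg => ?_
    simp_rw [Finset.mul_sum]
    rw [integral_finsetSum]
    · refine Finset.sum_eq_zero fun x _ => ?_
      have e : ∀ ω, Y ω * (V * c x * rescaledIntegral α g ε x ω) =
          (V * c x) * (Y ω * rescaledIntegral α g ε x ω) := fun ω => by ring
      simp_rw [e]
      rw [integral_const_mul, hbg.integral_mul_rescaledIntegral_eq_zero hY hYg, mul_zero]
    · exact fun x _ => hY.integrable_mul ((hbg.memLp_rescaledIntegral x).const_mul _)
  have hlim1 : Tendsto (fun ε => ∫ ω, Complex.exp (((∑ x ∈ I, (V * c x) *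
      rescaledIntegral α g ε x ω : ℝ) : ℂ) * Complex.I) ∂P) (𝓝[>] 0)
      (𝓝 (Complex.exp (-((V ^ 2 * κ / (H * (2 * H - 1)) *
        ∑ x ∈ I, ∑ y ∈ I, c x * c y * fbmKernel H x y : ℝ) : ℂ) / 2))) := by
    simp_rw [hchar]
    have hcont : Continuous fun s : ℝ => Complex.exp (-(s : ℂ) / 2) := by fun_prop
    exact (hcont.tendsto _).comp hvar
  -- Replacing `Φ(g)` by its linear part changes the characteristic function by at most the `L²`
  -- norm of the remainder.
  have hdiff : Tendsto (fun ε => ∫ ω, Complex.exp (((∑ x ∈ I, c x *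
        rescaledIntegral α (fun u ω => Φ (g u ω)) ε x ω : ℝ) : ℂ) * Complex.I) ∂P -
      ∫ ω, Complex.exp (((∑ x ∈ I, (V * c x) *
      rescaledIntegral α g ε x ω : ℝ) : ℂ) * Complex.I) ∂P) (𝓝[>] 0) (𝓝 0) := by
    have hsqrt := (Real.continuous_sqrt.tendsto 0).comp hrem
    rw [Real.sqrt_zero] at hsqrt
    refine squeeze_zero_norm (fun ε => ?_) hsqrt
    refine (norm_integral_exp_sub_le (hnon ε) (hlin ε)).trans (le_of_eq ?_)
    simp only [Function.comp_apply]
    congr 1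
    refine integral_congr_ae ?_
    filter_upwards [hg.ae_rescaledIntegral_eq_add hΦ] with ω hω
    rw [← Finset.sum_sub_distrib]
    congr 1
    refine Finset.sum_congr rfl fun x _ => ?_
    rw [hω ε x]; ring
  have := hdiff.add hlim1
  simpa using this

/-- A Kolmogorov bound for the rescaled integrals, uniform in the scale. -/
theorem IsLongRangeGaussianField.exists_integral_sq_increment_le
    (hg : IsLongRangeGaussianField g P α κ) (hα : α ∈ Set.Ioo (0 : ℝ) 1)
    (hΦ : IsRankOneTransform Φ) :
    ∃ C : ℝ, 0 ≤ C ∧ ∀ ε : ℝ, 0 < ε → ∀ x y,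
      ∫ ω, (rescaledIntegral α (fun u ω => Φ (g u ω)) ε y ω -
        rescaledIntegral α (fun u ω => Φ (g u ω)) ε x ω) ^ 2 ∂P ≤ C * |y - x| ^ (2 - α) := by
  obtain ⟨C, hC0, hC⟩ := hg.exists_rescaled_cov_le hα.1
  obtain ⟨D, hD0, hD⟩ := hg.exists_abs_integral_rankTwoPart_le hΦ
  set V := hermiteCoeff Φ 1
  have hα1 := hα.2
  have hk : 0 ≤ 2 / ((1 - α) * (2 - α)) := by
    have h1 : 0 < 1 - α := by linarith
    have h2 : 0 < 2 - α := by linarith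
    positivity
  -- From `(p + q)² ≤ 2p² + 2q²` for the linear part and the remainder; `D * C` arises because `R² ≤
  -- |R|` when `|R| ≤ 1`.
  refine ⟨2 * V ^ 2 * (C * (2 / ((1 - α) * (2 - α)))) +
    2 * (D * C * (2 / ((1 - α) * (2 - α)))), by positivity, fun ε hε x y => ?_⟩
  have hbg := hg.isBoundedL2Process
  have hbr := hg.isBoundedL2Process_rankTwoPart hΦ
  have h1 := hbg.integral_sq_increment_le (α := α) hα.2 hε (C := C) (fun u v huv => by
    rw [hg.integral_mul, ← sub_div]
    have := hC ε hε (v - u) (sub_ne_zero.2 huv.symm)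
    rwa [abs_mul, abs_of_pos (show 0 < ε ^ (-α) by positivity)] at this) x y
  have h2 := hbr.integral_sq_increment_le (α := α) hα.2 hε (C := D * C) (fun u v huv => by
    have h3 := hC ε hε (v - u) (sub_ne_zero.2 huv.symm)
    rw [abs_mul, abs_of_pos (show 0 < ε ^ (-α) by positivity)] at h3
    have h4 := hD (u / ε) (v / ε)
    rw [← sub_div, ← sq_abs] at h4
    have h5 := hg.abs_stationaryCov_le_one ((v - u) / ε)
    calc ε ^ (-α) * _ ≤ ε ^ (-α) * (D * |stationaryCov g P ((v - u) / ε)| ^ 2) := by gcongr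
      _ ≤ ε ^ (-α) * (D * |stationaryCov g P ((v - u) / ε)| ^ 1) := by
          have := pow_le_pow_of_le_one (abs_nonneg _) h5 (show 1 ≤ 2 by norm_num)
          gcongr
      _ = D * (ε ^ (-α) * |stationaryCov g P ((v - u) / ε)|) := by ring
      _ ≤ D * (C * |v - u| ^ (-α)) := by gcongr
      _ = _ := by ring) x y
  have m1 : MemLp (fun ω => rescaledIntegral α g ε y ω - rescaledIntegral α g ε x ω) 2 P :=
    (hbg.memLp_rescaledIntegral y).sub (hbg.memLp_rescaledIntegral x)
  have m2 : MemLp (fun ω => rescaledIntegral α (fun u ω => rankTwoPart Φ (g u ω)) ε y ω -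
      rescaledIntegral α (fun u ω => rankTwoPart Φ (g u ω)) ε x ω) 2 P :=
    (hbr.memLp_rescaledIntegral y).sub (hbr.memLp_rescaledIntegral x)
  have h3 := integral_mono_of_nonneg (μ := P)
    (f := fun ω => (rescaledIntegral α (fun u ω => Φ (g u ω)) ε y ω -
        rescaledIntegral α (fun u ω => Φ (g u ω)) ε x ω) ^ 2)
    (Eventually.of_forall fun ω => sq_nonneg _)
    ((m1.integrable_sq.const_mul (2 * V ^ 2)).add (m2.integrable_sq.const_mul 2)) (by
      filter_upwards [hg.ae_rescaledIntegral_eq_add hΦ] with ω hω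
      simp only [Pi.add_apply]
      rw [hω ε y, hω ε x]
      nlinarith [sq_nonneg (V * (rescaledIntegral α g ε y ω - rescaledIntegral α g ε x ω) -
        (rescaledIntegral α (fun u ω => rankTwoPart Φ (g u ω)) ε y ω -
          rescaledIntegral α (fun u ω => rankTwoPart Φ (g u ω)) ε x ω))])
  refine h3.trans ?_
  simp only [Pi.add_apply]
  rw [integral_add (m1.integrable_sq.const_mul (2 * V ^ 2)) (m2.integrable_sq.const_mul 2),
    integral_const_mul, integral_const_mul]
  calc _ ≤ 2 * V ^ 2 * (C * (2 / ((1 - α) * (2 - α)) * |y - x| ^ (2 - α))) +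
        2 * (D * C * (2 / ((1 - α) * (2 - α)) * |y - x| ^ (2 - α))) := by gcongr
    _ = _ := by ring

end FiniteDimensional

/-! ### Prokhorov's theorem and identification of the limit -/

section PathSpace

/-- The characteristic function of the finite-dimensional distributions of a law on `C(ℝ)`. -/
noncomputable def pathCharFun (μ : Measure C(ℝ, ℝ)) (I : Finset ℝ) (c : ℝ → ℝ) : ℂ :=
  ∫ w : C(ℝ, ℝ), Complex.exp (((∑ x ∈ I, c x * w x : ℝ) : ℂ) * Complex.I) ∂μ

variable {ι : Type*} {l : Filter ι} {μ : ι → ProbabilityMeasure C(ℝ, ℝ)}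
  {S : Set (ProbabilityMeasure C(ℝ, ℝ))} {φ : Finset ℝ → (ℝ → ℝ) → ℂ}

/-- Characteristic functions depend continuously on the law, and a cluster point of a convergent
family in a Hausdorff space is its limit. -/
theorem pathCharFun_eq_of_mapClusterPt
    (hφ : ∀ I c, Tendsto (fun i => pathCharFun (μ i) I c) l (𝓝 (φ I c)))
    {ν : ProbabilityMeasure C(ℝ, ℝ)} (hν : MapClusterPt ν l μ) (I : Finset ℝ) (c : ℝ → ℝ) :
    pathCharFun ν I c = φ I c := by
  have hc : MapClusterPt (pathCharFun ν I c) l (fun i => pathCharFun (μ i) I c) :=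
    hν.continuousAt_comp (continuous_integral_exp_sum_eval I c).continuousAt
  have : (𝓝 (pathCharFun ν I c) ⊓ 𝓝 (φ I c)).NeBot :=
    NeBot.mono hc (inf_le_inf_left _ (hφ I c))
  exact eq_of_nhds_neBot this

/-- Prokhorov: tightness and convergence of finite-dimensional distributions produce a limit. -/
theorem exists_probabilityMeasure_pathCharFun_eq [l.NeBot]
    (hS : IsTightMeasureSet {((ρ : ProbabilityMeasure C(ℝ, ℝ)) : Measure C(ℝ, ℝ)) | ρ ∈ S})
    (hμ : ∀ᶠ i in l, μ i ∈ S)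
    (hφ : ∀ I c, Tendsto (fun i => pathCharFun (μ i) I c) l (𝓝 (φ I c))) :
    ∃ ν : ProbabilityMeasure C(ℝ, ℝ), ∀ I c, pathCharFun ν I c = φ I c := by
  obtain ⟨ν, -, hν⟩ := (isCompact_closure_of_isTightMeasureSet hS).exists_mapClusterPt
    (f := l) (u := μ) (le_principal_iff.2 (hμ.mono fun i hi => subset_closure hi))
  exact ⟨ν, pathCharFun_eq_of_mapClusterPt hφ hν⟩

/-- Tightness and convergence of finite-dimensional distributions imply weak convergence. -/
theorem tendsto_of_tendsto_pathCharFun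
    (hS : IsTightMeasureSet {((ρ : ProbabilityMeasure C(ℝ, ℝ)) : Measure C(ℝ, ℝ)) | ρ ∈ S})
    (hμ : ∀ᶠ i in l, μ i ∈ S)
    (hφ : ∀ I c, Tendsto (fun i => pathCharFun (μ i) I c) l (𝓝 (φ I c)))
    {ν : ProbabilityMeasure C(ℝ, ℝ)} (hν : ∀ I c, pathCharFun ν I c = φ I c) :
    Tendsto μ l (𝓝 ν) := by
  refine (isCompact_closure_of_isTightMeasureSet hS).tendsto_nhds_of_unique_mapClusterPt
    (hμ.mono fun i hi => subset_closure hi) fun ρ _ hρ => ?_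
  have h : (ρ : Measure C(ℝ, ℝ)) = ν := measure_continuousMap_ext fun I c =>
    (pathCharFun_eq_of_mapClusterPt hφ hρ I c).trans (hν I c).symm
  exact Subtype.ext h

theorem pathCharFun_map {Ω : Type*} [MeasurableSpace Ω] {P : Measure Ω} {W : Ω → C(ℝ, ℝ)}
    (hW : AEMeasurable W P) (I : Finset ℝ) (c : ℝ → ℝ) :
    pathCharFun (P.map W) I c =
      ∫ ω, Complex.exp (((∑ x ∈ I, c x * W ω x : ℝ) : ℂ) * Complex.I) ∂P := by
  rw [pathCharFun, integral_map hW]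
  exact Continuous.aestronglyMeasurable (by fun_prop)

end PathSpace

/-! ### Recognising fractional Brownian motion from characteristic functions -/

section FractionalBrownianMotion

variable {H : ℝ}

theorem IsFractionalBrownianMotion.integral_exp {Ω : Type*} [MeasurableSpace Ω] {P : Measure Ω}
    {W : ℝ → Ω → ℝ} (hW : IsFractionalBrownianMotion W P H) (I : Finset ℝ) (c : ℝ → ℝ) :
    ∫ ω, Complex.exp (((∑ x ∈ I, c x * W x ω : ℝ) : ℂ) * Complex.I) ∂P =
      Complex.exp (-((∑ x ∈ I, ∑ y ∈ I, c x * c y * fbmKernel H x y : ℝ) : ℂ) / 2) := by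
  have hL : ∀ x, MemLp (W x) 2 P := fun x => (hW.gaussian.hasGaussianLaw_eval x).memLp_two
  have : IsProbabilityMeasure P := hW.gaussian.isProbabilityMeasure
  have hG : HasGaussianLaw (fun ω => ∑ x ∈ I, c x * W x ω) P :=
    (hW.gaussian.smul c).hasGaussianLaw_fun_sum
  have hG0 : ∫ ω, ∑ x ∈ I, c x * W x ω ∂P = 0 := by
    rw [integral_finsetSum _ fun x _ => ((hL x).integrable (by norm_num)).const_mul (c x)]
    simp [integral_const_mul, hW.centered]
  rw [hG.integral_exp_mul_I hG0, integral_sq_sum hL]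
  simp_rw [hW.covariance, fbmKernel]

/-- A law on `C(ℝ)` whose linear functionals have the right characteristic functions is the law of
a fractional Brownian motion. -/
theorem isFractionalBrownianMotion_of_pathCharFun (ν : Measure C(ℝ, ℝ)) [IsProbabilityMeasure ν]
    (h : ∀ I c, pathCharFun ν I c =
      Complex.exp (-((∑ x ∈ I, ∑ y ∈ I, c x * c y * fbmKernel H x y : ℝ) : ℂ) / 2)) :
    IsFractionalBrownianMotion (fun (x : ℝ) (w : C(ℝ, ℝ)) => w x) ν H := by
  have hlaw : ∀ (I : Finset ℝ) (c : ℝ → ℝ),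
      0 ≤ ∑ x ∈ I, ∑ y ∈ I, c x * c y * fbmKernel H x y ∧
      ν.map (fun w : C(ℝ, ℝ) => ∑ x ∈ I, c x * w x) =
        gaussianReal 0 (∑ x ∈ I, ∑ y ∈ I, c x * c y * fbmKernel H x y).toNNReal := by
    intro I c
    have hm : Measurable (fun w : C(ℝ, ℝ) => ∑ x ∈ I, c x * w x) :=
      (continuous_sum_eval I c).measurable
    have : IsProbabilityMeasure (ν.map (fun w : C(ℝ, ℝ) => ∑ x ∈ I, c x * w x)) :=
      Measure.isProbabilityMeasure_map hm.aemeasurable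
    set s := ∑ x ∈ I, ∑ y ∈ I, c x * c y * fbmKernel H x y with hs
    have hchar : ∀ t : ℝ, charFun (ν.map (fun w : C(ℝ, ℝ) => ∑ x ∈ I, c x * w x)) t =
        Complex.exp (-((t ^ 2 * s : ℝ) : ℂ) / 2) := by
      intro t
      rw [charFun_apply_real, integral_map hm.aemeasurable (by fun_prop)]
      have := h I (fun x => t * c x)
      have e : ∑ x ∈ I, ∑ y ∈ I, t * c x * (t * c y) * fbmKernel H x y = t ^ 2 * s := by
        rw [hs, Finset.mul_sum]
        refine Finset.sum_congr rfl fun x _ => ?_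
        rw [Finset.mul_sum]
        exact Finset.sum_congr rfl fun y _ => by ring
      rw [e] at this
      rw [← this, pathCharFun]
      congr 1
      ext w
      congr 2
      simp_rw [mul_assoc t, ← Finset.mul_sum]
      push_cast
      ring
    -- Positivity of the quadratic form is not assumed: it follows because `exp(-s/2)` is a value of
    -- a characteristic function, hence at most `1`.
    have hs0 : 0 ≤ s := by
      have h1 := norm_charFun_le_one (μ := ν.map (fun w : C(ℝ, ℝ) => ∑ x ∈ I, c x * w x)) (1 : ℝ)
      rw [hchar, Complex.norm_exp, Real.exp_le_one_iff] at h1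
      have : (-((1 ^ 2 * s : ℝ) : ℂ) / 2).re = -s / 2 := by
        rw [one_pow, one_mul]
        have : -(s : ℂ) / 2 = ((-s / 2 : ℝ) : ℂ) := by push_cast; ring
        rw [this, Complex.ofReal_re]
      rw [this] at h1
      linarith
    refine ⟨hs0, Measure.ext_of_charFun ?_⟩
    ext t
    rw [hchar, charFun_gaussianReal, Real.coe_toNNReal _ hs0]
    congr 1
    push_cast
    ring
  have hgauss : IsGaussianProcess (fun (x : ℝ) (w : C(ℝ, ℝ)) => w x) ν := by
    refine ⟨fun I => ⟨?_⟩⟩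
    have hr : Measurable (fun w : C(ℝ, ℝ) => I.restrict fun x => w x) :=
      (continuous_pi fun x : I => continuous_eval_const (F := C(ℝ, ℝ)) (x : ℝ)).measurable
    refine isGaussian_of_map_eq_gaussianReal fun L => ?_
    -- Coordinates of `L` in the standard basis, extended by zero outside `I`; each linear
    -- functional then falls under `hlaw`.
    let c : ℝ → ℝ := fun x => if hx : x ∈ I then L (Pi.single ⟨x, hx⟩ 1) else 0
    refine ⟨0, _, Eq.trans ?_ (hlaw I c).2⟩
    rw [Measure.map_map L.continuous.measurable hr]
    congr 1
    ext w
    rw [← Finset.sum_coe_sort I, Function.comp_apply]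
    conv_lhs => rw [← Finset.univ_sum_single (I.restrict fun x => w x), map_sum]
    refine Finset.sum_congr rfl fun x _ => ?_
    have : Pi.single (M := fun _ : I => ℝ) x (I.restrict (fun x => w x) x) =
        (w (x : ℝ) : ℝ) • Pi.single (M := fun _ : I => ℝ) x 1 := by
      rw [← Pi.single_smul]; simp
    rw [this, map_smul, smul_eq_mul, mul_comm]
    simp [c]
  have hL : ∀ x, MemLp (fun w : C(ℝ, ℝ) => w x) 2 ν := fun x =>
    (hgauss.hasGaussianLaw_eval x).memLp_two
  have hmean : ∀ x, ∫ w : C(ℝ, ℝ), w x ∂ν = 0 := by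
    intro x
    have h1 := (hlaw {x} fun _ => 1).2
    have hm : AEMeasurable (fun w : C(ℝ, ℝ) => w x) ν := (hL x).1.aemeasurable
    simp only [Finset.sum_singleton, one_mul] at h1
    have h2 := integral_map hm (f := fun z : ℝ => z) (by fun_prop)
    rw [← h2, h1, integral_id_gaussianReal]
  have hsecond : ∀ (I : Finset ℝ) (c : ℝ → ℝ), ∫ w : C(ℝ, ℝ), (∑ x ∈ I, c x * w x) ^ 2 ∂ν =
      ∑ x ∈ I, ∑ y ∈ I, c x * c y * fbmKernel H x y := by
    intro I c
    obtain ⟨hs0, h1⟩ := hlaw I c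
    have hm : AEMeasurable (fun w : C(ℝ, ℝ) => ∑ x ∈ I, c x * w x) ν :=
      (continuous_sum_eval I c).measurable.aemeasurable
    have h2 := integral_map hm (f := fun z : ℝ => z ^ 2) (by fun_prop)
    rw [← h2, h1]
    have h3 := variance_of_integral_eq_zero (X := fun z : ℝ => z) (μ := gaussianReal 0
      (∑ x ∈ I, ∑ y ∈ I, c x * c y * fbmKernel H x y).toNNReal)
      aemeasurable_id integral_id_gaussianReal
    rw [← h3, variance_fun_id_gaussianReal, Real.coe_toNNReal _ hs0]
  refine ⟨hgauss, hmean, fun x y => ?_⟩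
  change _ = fbmKernel H x y
  have hsymm : fbmKernel H y x = fbmKernel H x y := by
    rw [fbmKernel, fbmKernel, abs_sub_comm]; ring
  have hdiag : ∀ x, ∫ w : C(ℝ, ℝ), w x ^ 2 ∂ν = fbmKernel H x x := fun x => by
    simpa using hsecond {x} fun _ => 1
  -- For distinct points the covariance is read off from the variance of `w x + w y`; the diagonal
  -- is separate because `{x, y}` then has one element.
  rcases eq_or_ne x y with rfl | hxy
  · rw [← hdiag]
    simp_rw [sq]
  · have h1 := hsecond {x, y} fun _ => 1
    rw [integral_sq_sum hL] at h1
    simp only [Finset.sum_pair hxy, one_mul] at h1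
    have h2 : ∫ w : C(ℝ, ℝ), w y * w x ∂ν = ∫ w : C(ℝ, ℝ), w x * w y ∂ν := by
      simp_rw [mul_comm]
    have hd : ∀ x, ∫ w : C(ℝ, ℝ), w x * w x ∂ν = fbmKernel H x x := fun x => by
      rw [← hdiag]; simp_rw [sq]
    rw [h2, hd, hd, hsymm] at h1
    linarith

end FractionalBrownianMotion

/-! ### Laws of the rescaled paths and the main theorem -/

section Main

variable {Ω : Type*} [MeasurableSpace Ω] {P : Measure Ω} [IsProbabilityMeasure P]
  {g b : ℝ → Ω → ℝ} {α κ : ℝ} {Φ : ℝ → ℝ}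

theorem IsBoundedL2Process.aemeasurable_rescaledPath (hb : IsBoundedL2Process b P) (ε : ℝ) :
    AEMeasurable (rescaledPath α b ε) P := by
  refine aemeasurable_continuousMap_of_eval fun x => ?_
  refine (hb.memLp_rescaledIntegral (α := α) (ε := ε) x).1.aemeasurable.congr ?_
  filter_upwards [hb.ae_locallyIntegrable] with ω hω
  exact (rescaledPath_apply hω x).symm

/-- The law on `C(ℝ)` of the rescaled path. -/
noncomputable def rescaledLaw (hb : IsBoundedL2Process b P) (α ε : ℝ) :
    ProbabilityMeasure C(ℝ, ℝ) :=
  ⟨P.map (rescaledPath α b ε),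
    Measure.isProbabilityMeasure_map (hb.aemeasurable_rescaledPath ε)⟩

theorem pathCharFun_rescaledLaw (hb : IsBoundedL2Process b P) (ε : ℝ) (I : Finset ℝ) (c : ℝ → ℝ) :
    pathCharFun (rescaledLaw hb α ε) I c =
      ∫ ω, Complex.exp (((∑ x ∈ I, c x * rescaledIntegral α b ε x ω : ℝ) : ℂ) * Complex.I) ∂P := by
  refine (pathCharFun_map (hb.aemeasurable_rescaledPath ε) I c).trans ?_
  refine integral_congr_ae ?_
  filter_upwards [hb.ae_locallyIntegrable] with ω hω
  simp_rw [rescaledPath_apply hω]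

/-- The increment exponent is `2 - α = 1 + (1 - α)`, so Kolmogorov's criterion applies with `δ = 1 -
α > 0`, uniformly over all `ε > 0`. -/
theorem isTightMeasureSet_rescaledLaw (hg : IsLongRangeGaussianField g P α κ)
    (hα : α ∈ Set.Ioo (0 : ℝ) 1) (hΦ : IsRankOneTransform Φ)
    (hb : IsBoundedL2Process (fun u ω => Φ (g u ω)) P) :
    IsTightMeasureSet {((ρ : ProbabilityMeasure C(ℝ, ℝ)) : Measure C(ℝ, ℝ)) |
      ρ ∈ rescaledLaw hb α '' Set.Ioi 0} := by
  obtain ⟨C, hC0, hC⟩ := hg.exists_integral_sq_increment_le hα hΦ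
  refine isTightMeasureSet_of_second_moment_increments hC0 (sub_pos.2 hα.2) ?_ ?_
  · rintro _ ⟨_, ⟨ε, hε, rfl⟩, rfl⟩
    change ∀ᵐ w : C(ℝ, ℝ) ∂(P.map _), w 0 = 0
    rw [ae_map_iff (hb.aemeasurable_rescaledPath ε)
      (measurableSet_eq_fun (continuous_eval_const (F := C(ℝ, ℝ)) (0 : ℝ)).measurable
        measurable_const)]
    filter_upwards [hb.ae_locallyIntegrable] with ω hω
    rw [rescaledPath_apply hω, rescaledIntegral_zero]
  · rintro _ ⟨_, ⟨ε, hε, rfl⟩, rfl⟩ x y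
    have hm : Measurable fun w : C(ℝ, ℝ) => ENNReal.ofReal ((w x - w y) ^ 2) :=
      ENNReal.measurable_ofReal.comp (Continuous.measurable (by fun_prop))
    change ∫⁻ w : C(ℝ, ℝ), ENNReal.ofReal ((w x - w y) ^ 2) ∂(P.map _) ≤ _
    rw [lintegral_map' hm.aemeasurable (hb.aemeasurable_rescaledPath ε)]
    have hL : MemLp (fun ω => rescaledIntegral α (fun u ω => Φ (g u ω)) ε x ω -
        rescaledIntegral α (fun u ω => Φ (g u ω)) ε y ω) 2 P :=
      (hb.memLp_rescaledIntegral x).sub (hb.memLp_rescaledIntegral y)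
    calc ∫⁻ ω, ENNReal.ofReal ((rescaledPath α (fun u ω => Φ (g u ω)) ε ω x -
          rescaledPath α (fun u ω => Φ (g u ω)) ε ω y) ^ 2) ∂P
        = ∫⁻ ω, ENNReal.ofReal ((rescaledIntegral α (fun u ω => Φ (g u ω)) ε x ω -
          rescaledIntegral α (fun u ω => Φ (g u ω)) ε y ω) ^ 2) ∂P := by
          refine lintegral_congr_ae ?_
          filter_upwards [hb.ae_locallyIntegrable] with ω hω
          rw [rescaledPath_apply hω, rescaledPath_apply hω]
      _ = ENNReal.ofReal (∫ ω, (rescaledIntegral α (fun u ω => Φ (g u ω)) ε x ω -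
          rescaledIntegral α (fun u ω => Φ (g u ω)) ε y ω) ^ 2 ∂P) :=
          (ofReal_integral_eq_lintegral_ofReal hL.integrable_sq
            (Eventually.of_forall fun _ => sq_nonneg _)).symm
      _ ≤ ENNReal.ofReal (C * |x - y| ^ (1 + (1 - α))) := by
          refine ENNReal.ofReal_le_ofReal ?_
          rw [show 1 + (1 - α) = 2 - α by ring]
          exact hC ε hε y x

end Main

theorem theorem3p1 {Ω : Type*} [MeasurableSpace Ω] (P : Measure Ω) [IsProbabilityMeasure P]
    (α κ : ℝ) (hα : α ∈ Set.Ioo (0 : ℝ) 1) (hκ : 0 < κ)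
    (g : ℝ → Ω → ℝ) (hg : IsLongRangeGaussianField g P α κ)
    (Φ : ℝ → ℝ) (hΦ : IsRankOneTransform Φ)
    (a : ℝ → Ω → ℝ) (ha : ∀ x ω, a x ω = Φ (g x ω))
    (H β : ℝ) (hH : H = 1 - α / 2)
    (hβ : β = Real.sqrt (hermiteCoeff Φ 1 ^ 2 * κ / (H * (2 * H - 1)))) :
    -- almost surely `a` is locally integrable, so the `W_ε` are given by genuine integrals
    -- and have continuous paths
    (∀ᵐ ω ∂P, LocallyIntegrable (fun y => a y ω) volume ∧
      ∀ ε > 0, ∀ x, rescaledPath α a ε ω x = ε ^ (-(α / 2)) * ∫ y in (0 : ℝ)..x, a (y / ε) ω) ∧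
    -- there is a fractional Brownian motion with continuous paths
    (∃ ν : ProbabilityMeasure C(ℝ, ℝ),
      IsFractionalBrownianMotion (fun (x : ℝ) (w : C(ℝ, ℝ)) => w x) (ν : Measure C(ℝ, ℝ)) H) ∧
    -- for every such `W`, `W_ε ⇒ β W` in `C(ℝ)` as `ε → 0⁺`
    (∀ {Ω' : Type*} [MeasurableSpace Ω'] (P' : Measure Ω') [IsProbabilityMeasure P']
      (W : Ω' → C(ℝ, ℝ)), IsFractionalBrownianMotion (fun x ω' => W ω' x) P' H →
      TendstoInDistribution (fun ε : ℝ => rescaledPath α a ε) (𝓝[>] (0 : ℝ))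
        (fun ω' => β • W ω') (fun _ => P) P') := by
  obtain rfl : a = fun u ω => Φ (g u ω) := funext fun x => funext fun ω => ha x ω
  have hb := hg.isBoundedL2Process_transform hΦ
  have htight := isTightMeasureSet_rescaledLaw hg hα hΦ hb
  have hmem : ∀ᶠ ε in 𝓝[>] (0 : ℝ), rescaledLaw hb α ε ∈ rescaledLaw hb α '' Set.Ioi 0 := by
    filter_upwards [self_mem_nhdsWithin] with ε hε using ⟨ε, hε, rfl⟩
  have hlim : ∀ I c, Tendsto (fun ε => pathCharFun (rescaledLaw hb α ε) I c) (𝓝[>] (0 : ℝ))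
      (𝓝 (Complex.exp (-((hermiteCoeff Φ 1 ^ 2 * κ / (H * (2 * H - 1)) *
        ∑ x ∈ I, ∑ y ∈ I, c x * c y * fbmKernel H x y : ℝ) : ℂ) / 2))) := by
    intro I c
    simp_rw [pathCharFun_rescaledLaw]
    exact hg.tendsto_charFun hα hκ hΦ hH I c
  have hpos : 0 < hermiteCoeff Φ 1 ^ 2 * κ / (H * (2 * H - 1)) := by
    have hα1 := hα.2
    have h1 : 0 < H := by rw [hH]; linarith
    have h2 : 0 < 2 * H - 1 := by rw [hH]; linarith
    have h3 := hΦ.hermiteCoeff_one_ne_zero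
    positivity
  -- Strict positivity, due to `V₁ ≠ 0` and `2H - 1 = 1 - α > 0`, allows division by `β` below.
  have hβ0 : 0 < β := by rw [hβ]; exact Real.sqrt_pos.2 hpos
  have hβ2 : hermiteCoeff Φ 1 ^ 2 * κ / (H * (2 * H - 1)) = β ^ 2 := by
    rw [hβ, Real.sq_sqrt hpos.le]
  rw [hβ2] at hlim
  have hscale : ∀ (t : ℝ) (I : Finset ℝ) (c : ℝ → ℝ),
      ∑ x ∈ I, ∑ y ∈ I, (t * c x) * (t * c y) * fbmKernel H x y =
        t ^ 2 * ∑ x ∈ I, ∑ y ∈ I, c x * c y * fbmKernel H x y := by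
    intro t I c
    simp_rw [Finset.mul_sum]
    exact Finset.sum_congr rfl fun x _ => Finset.sum_congr rfl fun y _ => by ring
  refine ⟨?_, ?_, ?_⟩
  · filter_upwards [hb.ae_locallyIntegrable] with ω hω
    exact ⟨hω, fun ε _ x => rescaledPath_apply hω x⟩
  -- A cluster law has the finite-dimensional distributions of `β W^H`, so its image under
  -- multiplication by `β⁻¹` is the required law.
  · obtain ⟨ν, hν⟩ := exists_probabilityMeasure_pathCharFun_eq htight hmem hlim
    have hm : Measurable fun w : C(ℝ, ℝ) => β⁻¹ • w :=
      (continuous_const_smul β⁻¹).measurable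
    refine ⟨ν.map hm.aemeasurable, isFractionalBrownianMotion_of_pathCharFun _ fun I c => ?_⟩
    have h1 : pathCharFun (ν.map hm.aemeasurable) I c = pathCharFun ν I fun x => β⁻¹ * c x := by
      refine (pathCharFun_map hm.aemeasurable I c).trans ?_
      rw [pathCharFun]
      congr 1
      ext w
      congr 3
      refine Finset.sum_congr rfl fun x _ => ?_
      simp only [ContinuousMap.coe_smul, Pi.smul_apply, smul_eq_mul]
      ring
    rw [h1, hν, hscale, ← mul_assoc, ← mul_pow, mul_inv_cancel₀ hβ0.ne', one_pow, one_mul]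
  · intro Ω' _ P' _ W hW
    have hWm : AEMeasurable (fun ω' => β • W ω') P' :=
      (continuous_const_smul β).measurable.comp_aemeasurable
        (aemeasurable_continuousMap_of_eval fun x => hW.gaussian.aemeasurable x)
    refine ⟨fun ε => hb.aemeasurable_rescaledPath ε, hWm, ?_⟩
    refine tendsto_of_tendsto_pathCharFun htight hmem hlim fun I c => ?_
    refine (pathCharFun_map hWm I c).trans ?_
    -- The factor `β²` is absorbed into the coefficients, which matches scaling the path by `β`.
    rw [← hscale, ← hW.integral_exp I fun x => β * c x]
    congr 1
    ext ω'
    congr 3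
    refine Finset.sum_congr rfl fun x _ => ?_
    simp only [ContinuousMap.coe_smul, Pi.smul_apply, smul_eq_mul]
    ring
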